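/- Let $p\ge 0$, let $T_1,T_2,\dots$ be non-negative integers with $\sup_i T_i<\infty$, let $x_{it}\in\mathbb R^p$ ($i\ge1$, $1\le t\le T_i$) be fixed covariate vectors, let $\beta\in\mathbb R^p$, and put $\lambda_{it}=\exp(x_{it}^{\mathsf T}\beta)$. Suppose that the counts $N_{it}$ follow the saturated random effect model: there are i.i.d. random variables $\theta_{it}\ge 0$ with mean $1$ and finite variance $\tau^2>0$ such that, given $\theta_{it}$, the count $N_{it}$ is Poisson with mean $\theta_{it}\lambda_{it}$, and the pairs $(\theta_{it},N_{it})$ are independent over all $(i,t)$. Assume that $$\frac1k\sum_{i=1}^k\Big(\sum_{t=1}^{T_i}\lambda_{it}\Big)^2$$ converges to a positive constant as $k\to\infty$. For each $k$ let $\widehat\beta=\widehat\beta_k$ be a random vector that, almost surely, whenever the likelihood of the Poisson regression model ($N_{it}\sim\mathrm{Pois}(\exp(x_{it}^{\mathsf T}b))$ independent) for the first $k$ policyholders has a maximizer, is such a maximizer. Let $\widehat\lambda_{it}=\exp(x_{it}^{\mathsf T}\widehat\beta_k)$ and $$\mathcal T_k=\frac{\sum_{i=1}^k\Big(\big(\sum_t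 (N_{it}-\widehat\lambda_{it})\big)^2-\sum_t N_{it}\Big)}{\sqrt{2\sum_{i=1}^k\big(\sum_t\widehat\lambda_{it}\big)^2}}$$ be Pinquet's score statistic. Then: 1. there is a constant $c>0$ with $P(\mathcal T_k\ge c\sqrt k)\to1$ as $k\to\infty$; 2. consequently, for every level $\alpha\in(0,1)$, the score test of $H_0:\mathrm{Var}(\theta_i)=0$, which rejects when $\mathcal T_k$ is at least the $1-\alpha$ quantile of $N(0,1)$, rejects with probability tending to one as $k\to\infty$; 3. if, moreover, the covariates are bounded and, for some $\kappa>0$ and all large $k$, the matrix $\sum_{i\le k}\sum_t\lambda_{it}x_{it}x_{it}^{\mathsf T}-\kappa k I$ is positive semidefinite, then the growth is exactly of order $\sqrt k$: there is also a constant $C$ with $P(\mathcal T_k\le C\sqrt k)\to1$. -/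

import Mathlib

open MeasureTheory ProbabilityTheory Filter Topology
open scoped NNReal ENNReal

noncomputable section

/-- The log-linear Poisson rate `exp (xᵀ b)` of one observation with covariate vector `x`. -/
def poissonRate {p : ℕ} (x b : Fin p → ℝ) : ℝ≥0 :=
  ⟨Real.exp (x ⬝ᵥ b), (Real.exp_pos _).le⟩

/-- The saturated random effect model. Policyholder `i` is observed in `T i` periods, with
covariates `x i t`, unobserved effects `θ i t ≥ 0` and claim counts `N i t`. The pairs
`(θ i t, N i t)` are independent, the effects are identically distributed with mean `1` and finite
variance `τ ^ 2`, and, given `θ i t`, the count `N i t` is Poisson with mean `θ i t * λ i t`,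
where `λ i t = exp (x i tᵀ β)`. -/
structure SaturatedRandomEffectModel {Ω : Type*} [MeasurableSpace Ω] (P : Measure Ω)
    [IsProbabilityMeasure P] {p : ℕ} (T : ℕ → ℕ) (x : (i : ℕ) → Fin (T i) → Fin p → ℝ)
    (β : Fin p → ℝ) (τ : ℝ) (θ : (i : ℕ) → Fin (T i) → Ω → ℝ≥0)
    (N : (i : ℕ) → Fin (T i) → Ω → ℕ) : Prop where
  measurable_effect : ∀ i t, Measurable (θ i t)
  measurable_count : ∀ i t, Measurable (N i t)
  indep : iIndepFun (fun (j : (i : ℕ) × Fin (T i)) (ω : Ω) => (θ j.1 j.2 ω, N j.1 j.2 ω)) P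
  identDistrib : ∀ i t i' t', IdentDistrib (θ i t) (θ i' t') P P
  memLp : ∀ i t, MemLp (fun ω => (θ i t ω : ℝ)) 2 P
  mean : ∀ i t, ∫ ω, (θ i t ω : ℝ) ∂P = 1
  variance : ∀ i t, variance (fun ω => (θ i t ω : ℝ)) P = τ ^ 2
  poisson : ∀ i t, ∀ᵐ r ∂(P.map (θ i t)),
    condDistrib (N i t) (θ i t) P r = poissonMeasure (r * poissonRate (x i t) β)

/-- The likelihood, at the parameter `b`, of the Poisson regression model (independent counts,
the count of policyholder `i` in period `t` being Poisson with mean `exp (x i tᵀ b)`) for the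
observed counts `n` of the first `k` policyholders. -/
def poissonLikelihood {p : ℕ} (T : ℕ → ℕ) (x : (i : ℕ) → Fin (T i) → Fin p → ℝ) (k : ℕ)
    (n : (i : ℕ) → Fin (T i) → ℕ) (b : Fin p → ℝ) : ℝ :=
  ∏ i ∈ Finset.range k, ∏ t, (poissonMeasure (poissonRate (x i t) b)).real {n i t}

/-- `b` is a maximum likelihood estimate in the Poisson regression model, for the observed counts
`n` of the first `k` policyholders. -/
def IsPoissonMLE {p : ℕ} (T : ℕ → ℕ) (x : (i : ℕ) → Fin (T i) → Fin p → ℝ) (k : ℕ)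
    (n : (i : ℕ) → Fin (T i) → ℕ) (b : Fin p → ℝ) : Prop :=
  ∀ b' : Fin p → ℝ, poissonLikelihood T x k n b' ≤ poissonLikelihood T x k n b

/-- Pinquet's score statistic for the first `k` policyholders, computed with the fitted means
`exp (x i tᵀ b)`. -/
def pinquetStatistic {p : ℕ} (T : ℕ → ℕ) (x : (i : ℕ) → Fin (T i) → Fin p → ℝ) (k : ℕ)
    (n : (i : ℕ) → Fin (T i) → ℕ) (b : Fin p → ℝ) : ℝ :=
  (∑ i ∈ Finset.range k,
      ((∑ t, ((n i t : ℝ) - (poissonRate (x i t) b : ℝ))) ^ 2 - ∑ t, (n i t : ℝ))) /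
    Real.sqrt (2 * ∑ i ∈ Finset.range k, (∑ t, (poissonRate (x i t) b : ℝ)) ^ 2)

/-- The usual regularity of the design of a Poisson regression at `β`: the covariates are bounded,
and the Fisher information of the first `k` policyholders is bounded below by a positive multiple
of `k` times the identity, for all large `k`. -/
def RegularDesign {p : ℕ} (T : ℕ → ℕ) (x : (i : ℕ) → Fin (T i) → Fin p → ℝ)
    (β : Fin p → ℝ) : Prop :=
  (∃ B : ℝ, ∀ i t j, |x i t j| ≤ B) ∧
  ∃ κ : ℝ, 0 < κ ∧ ∀ᶠ k : ℕ in atTop, ∀ v : Fin p → ℝ,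
    κ * k * (v ⬝ᵥ v) ≤
      ∑ i ∈ Finset.range k, ∑ t, (poissonRate (x i t) β : ℝ) * (x i t ⬝ᵥ v) ^ 2

end

/-! Write S_i for the total count of policyholder i, Λ_i(b) for its fitted mean, R(b)² = Σ Λ_i(b)²
and Q = R(β)². The numerator of the statistic at b is Σ(S_i² − S_i) − 2 Σ S_i Λ_i(b) + R(b)². Since
the effects are independent across periods, E(S_i² − S_i) = Λ_i(β)² + τ² Σ_t λ_it², and
Cauchy–Schwarz with bounded T_i makes this at least (1 + ρ)Λ_i(β)² for some ρ > 0. The mean of Σ S_i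
Λ_i(b) is at most √Q R(b). Up to fluctuations the numerator is thus at least (1 + ρ)Q − 2√Q R + R²,
which exceeds a constant times √k R because Q is of order k (`quadratic_growth`); the denominator is
√2 R. The bound holds for all b simultaneously, so the lower bound needs neither existence nor
consistency of the estimator.

The crux is this uniformity (`tendsto_measure_exists_correlation`): with high probability, Σ S_i
Λ_i(b) exceeds its mean by at most ε√k R(b) for every b, although b ranges over an unbounded set.
Counts are truncated at a multiple of a_i = 1 + Λ_i(β); uniform integrability and Cauchy–Schwarz
control the remainder. For the truncated counts a layer-cake decomposition reduces the claim to
level sets of exp(x·b)/a, which become half-spaces after taking logarithms. Half-spaces form a VC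
class, so Dudley's bound gives a net whose size does not depend on k, and Chebyshev's inequality on
each member suffices.

For the upper bound, the score at β is o(k) while the information is at least κk. Concavity of the
log-likelihood then forces a maximizer to exist and to lie in a fixed ball around β. There the
fitted and true rates agree up to a factor e², so the numerator is O(k) and the denominator at least
of order √k. -/

/-! ### Half-spaces as a VC class, and Dudley's packing bound -/

open Classical in
/-- The indices in `s` on which the linear functional `c` is positive. -/
noncomputable def positivitySet {κ ι : Type*} [Fintype κ] (s : Finset ι) (y : ι → κ → ℝ)
    (c : κ → ℝ) : Finset ι :=
  s.filter fun j => 0 < y j ⬝ᵥ c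

section PositivitySet

variable {κ ι : Type*} [Fintype κ]

lemma mem_positivitySet {s : Finset ι} {y : ι → κ → ℝ} {c : κ → ℝ} {j : ι} :
    j ∈ positivitySet s y c ↔ j ∈ s ∧ 0 < y j ⬝ᵥ c := by
  simp [positivitySet]

lemma positivitySet_subset (s : Finset ι) (y : ι → κ → ℝ) (c : κ → ℝ) :
    positivitySet s y c ⊆ s := fun _ h => (mem_positivitySet.1 h).1

/-- More vectors than dimensions satisfy a linear relation Σ g_j y_j = 0. If c were positive exactly
where g is, pairing the relation with c would give a sum of nonnegative terms, one of them strictly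
positive. -/
lemma card_le_of_shatters_positivitySet [DecidableEq ι] (s t : Finset ι) (y : ι → κ → ℝ)
    (𝒜 : Finset (Finset ι)) (h𝒜 : ∀ A ∈ 𝒜, ∃ c, A = positivitySet t y c) (hs : 𝒜.Shatters s) :
    s.card ≤ Fintype.card κ := by
  by_contra hlt
  have hli : ¬ LinearIndependent ℝ (fun j : s => y j) := fun h => by
    have := h.fintype_card_le_finrank
    simp at this
    omega
  have key : ∀ g : s → ℝ, ∑ j, g j • y j = 0 → ∀ i, ¬ 0 < g i := by
    intro g hg i hi
    obtain ⟨A, hA, hsA⟩ := hs (Finset.filter_subset (fun j => ∃ h : j ∈ s, 0 < g ⟨j, h⟩) s)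
    obtain ⟨c, rfl⟩ := h𝒜 A hA
    -- Only used to know that `s` lies inside `t`.
    obtain ⟨B, hB, hsB⟩ := hs.exists_superset
    obtain ⟨c', rfl⟩ := h𝒜 B hB
    have hmem : ∀ j : s, 0 < y j ⬝ᵥ c ↔ 0 < g j := by
      intro j
      have h1 := congrArg (fun F => (j : ι) ∈ F) hsA
      simp only [Finset.mem_inter, j.2, true_and, Finset.mem_filter, mem_positivitySet,
        (positivitySet_subset t y c' (hsB j.2)), exists_true_left] at h1
      exact iff_of_eq h1
    have hzero : ∑ j, g j * (y j ⬝ᵥ c) = 0 := by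
      have := congrArg (fun v => v ⬝ᵥ c) hg
      simpa [sum_dotProduct, smul_dotProduct] using this
    have hpos : 0 < ∑ j, g j * (y j ⬝ᵥ c) := by
      refine Finset.sum_pos' (fun j _ => ?_) ⟨i, Finset.mem_univ _, mul_pos hi ((hmem i).2 hi)⟩
      by_cases hj : 0 < g j
      · exact (mul_pos hj ((hmem j).2 hj)).le
      · have := (hmem j).not.2 hj
        exact mul_nonneg_of_nonpos_of_nonpos (not_lt.1 hj) (not_lt.1 this)
    exact hpos.ne' hzero
  obtain ⟨g, hg, i, hi⟩ := Fintype.not_linearIndependent_iff.1 hli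
  rcases lt_or_gt_of_ne hi with h | h
  · refine key (fun j => - g j) ?_ i (by simpa using h)
    simpa using hg
  · exact key g hg i h

/-- Sauer–Shelah: a family has no more members than it shatters sets, and a set of at most d points
is encoded by a map from `Fin d` to `Option (Fin n)`. -/
lemma card_positivitySet_le {n : ℕ} (y : Fin n → κ → ℝ) (𝒜 : Finset (Finset (Fin n)))
    (h𝒜 : ∀ A ∈ 𝒜, ∃ c, A = positivitySet Finset.univ y c) :
    𝒜.card ≤ (n + 1) ^ Fintype.card κ := by
  have hsub : 𝒜.shatterer ⊆ (Finset.univ : Finset (Finset (Fin n))).filter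
      (fun s => s.card ≤ Fintype.card κ) := by
    intro s hs
    simp only [Finset.mem_filter, Finset.mem_univ, true_and]
    exact card_le_of_shatters_positivitySet s _ y 𝒜 h𝒜 (Finset.mem_shatterer.1 hs)
  refine 𝒜.card_le_card_shatterer.trans ((Finset.card_le_card hsub).trans ?_)
  set d := Fintype.card κ
  have hmap : Finset.univ.filter (fun s : Finset (Fin n) => s.card ≤ d) ⊆
      (Finset.univ : Finset (Fin d → Option (Fin n))).image
        (fun f => Finset.univ.filter fun a => ∃ i, f i = some a) := by
    intro s hs
    simp only [Finset.mem_filter, Finset.mem_univ, true_and] at hs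
    simp only [Finset.mem_image, Finset.mem_univ, true_and]
    refine ⟨fun i => if h : (i : ℕ) < s.card then some (s.equivFin.symm ⟨i, h⟩) else none, ?_⟩
    ext a
    simp only [Finset.mem_filter, Finset.mem_univ, true_and]
    constructor
    · rintro ⟨i, hi⟩
      split_ifs at hi with h
      · have := Option.some.inj hi
        rw [← this]
        exact (s.equivFin.symm ⟨i, h⟩).2
    · intro ha
      refine ⟨⟨s.equivFin ⟨a, ha⟩, (s.equivFin ⟨a, ha⟩).2.trans_le hs⟩, ?_⟩
      simp
  refine (Finset.card_le_card hmap).trans (Finset.card_image_le.trans ?_)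
  simp

/-- Dudley's packing bound: only boundedly many positivity sets can be pairwise far apart, with
respect to every finite measure on the index set. -/
lemma exists_packing_bound (κ ι : Type*) [Fintype κ] [DecidableEq ι] {ε : ℝ} (hε : 0 < ε) :
    ∃ N : ℕ, ∀ (s : Finset ι) (y : ι → κ → ℝ) (w : ι → ℝ), (∀ j ∈ s, 0 ≤ w j) →
      ∀ c : Fin N → κ → ℝ, ∃ a b, a ≠ b ∧
        ∑ j ∈ symmDiff (positivitySet s y (c a)) (positivitySet s y (c b)), w j
          ≤ ε * ∑ j ∈ s, w j := by
  wlog hε1 : ε < 1 generalizing ε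
  · obtain ⟨N, hN⟩ := this (ε := 1 / 2) (by norm_num) (by norm_num)
    refine ⟨N, fun s y w hw c => ?_⟩
    obtain ⟨a, b, hab, h⟩ := hN s y w hw c
    refine ⟨a, b, hab, h.trans (mul_le_mul_of_nonneg_right ?_ (Finset.sum_nonneg hw))⟩
    linarith [not_lt.1 hε1]
  set D := Fintype.card κ
  -- Here n is a sample size: polynomially many traces on n points, against an exponentially small
  -- chance that a sample misses a set of relative weight ε.
  obtain ⟨n, hn⟩ : ∃ n : ℕ, (((n + 1 : ℕ) : ℝ) ^ D + 1) ^ 2 * (1 - ε) ^ n < 1 := by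
    have h0 : Tendsto (fun n : ℕ => ((n : ℝ)) ^ (2 * D) * (1 - ε) ^ n) atTop (𝓝 0) :=
      tendsto_pow_const_mul_const_pow_of_abs_lt_one _ (by rw [abs_lt]; constructor <;> linarith)
    have h1 := ((h0.comp (tendsto_add_atTop_nat 1)).const_mul (4 / (1 - ε)))
    rw [mul_zero] at h1
    obtain ⟨n, hn⟩ := (h1.eventually (gt_mem_nhds one_pos)).exists
    refine ⟨n, lt_of_le_of_lt ?_ hn⟩
    have hp : (1 : ℝ) ≤ ((n + 1 : ℕ) : ℝ) ^ D := one_le_pow₀ (by simp)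
    have h2 : (((n + 1 : ℕ) : ℝ) ^ D + 1) ^ 2 ≤ 4 * ((n + 1 : ℕ) : ℝ) ^ (2 * D) := by
      rw [mul_comm 2 D, pow_mul]; nlinarith
    have h3 : (0 : ℝ) < 1 - ε := by linarith
    calc _ ≤ 4 * ((n + 1 : ℕ) : ℝ) ^ (2 * D) * (1 - ε) ^ n := by gcongr
      _ = _ := by
        simp only [Function.comp_apply, pow_succ (1 - ε)]
        field_simp
  obtain ⟨N, hND⟩ : ∃ N, N = (n + 1) ^ D + 1 := ⟨_, rfl⟩
  refine ⟨N, fun s y w hw c => ?_⟩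
  by_contra! hcon
  set W := ∑ j ∈ s, w j with hW
  let H : Fin N → Finset ι := fun a => positivitySet s y (c a)
  let Q : Finset (Fin N × Fin N) := Finset.univ.filter fun q => q.1 ≠ q.2
  -- The n-samples that fail to separate the two sets of the pair `q`.
  let E : Fin N × Fin N → Finset (Fin n → ι) :=
    fun q => Fintype.piFinset fun _ => s \ symmDiff (H q.1) (H q.2)
  have hHs : ∀ a b, symmDiff (H a) (H b) ⊆ s := fun a b j hj => by
    rcases Finset.mem_symmDiff.1 hj with h | h <;> exact positivitySet_subset _ _ _ h.1
  -- There are N sets but at most N − 1 traces on any sample, so two sets have the same trace.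
  have hcover : Fintype.piFinset (fun _ : Fin n => s) ⊆ Q.biUnion E := by
    intro f hf
    rw [Fintype.mem_piFinset] at hf
    let G : Fin N → Finset (Fin n) := fun a => positivitySet Finset.univ (fun i => y (f i)) (c a)
    have hcard : (Finset.univ.image G).card < (Finset.univ : Finset (Fin N)).card := by
      have := card_positivitySet_le (fun i => y (f i)) (Finset.univ.image G) (by
        intro A hA
        obtain ⟨a, -, rfl⟩ := Finset.mem_image.1 hA
        exact ⟨c a, rfl⟩)
      simp only [Finset.card_univ, Fintype.card_fin]
      exact (Nat.lt_succ_of_le this).trans_eq hND.symm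
    obtain ⟨a, -, b, -, hab, hG⟩ := Finset.exists_ne_map_eq_of_card_lt_of_maps_to hcard
      (fun a ha => Finset.mem_image_of_mem G ha)
    simp only [Finset.mem_biUnion]
    refine ⟨(a, b), by simp [Q, hab], ?_⟩
    rw [Fintype.mem_piFinset]
    intro i
    have h1 := congrArg (fun F => i ∈ F) hG
    simp only [G, mem_positivitySet, Finset.mem_univ, true_and, eq_iff_iff] at h1
    simp only [Finset.mem_sdiff, hf i, true_and, Finset.mem_symmDiff, H, mem_positivitySet, h1]
    tauto
  have hprod : ∀ f ∈ Fintype.piFinset (fun _ : Fin n => s), 0 ≤ ∏ i, w (f i) := fun f hf =>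
    Finset.prod_nonneg fun i _ => hw _ (Fintype.mem_piFinset.1 hf i)
  have hEsub : ∀ q, E q ⊆ Fintype.piFinset (fun _ : Fin n => s) := fun q =>
    Fintype.piFinset_subset _ _ fun _ => Finset.sdiff_subset
  have hW0 : 0 < W := by
    have hN : 1 < N := by
      rw [hND]
      have : 0 < (n + 1) ^ D := by positivity
      omega
    have h := hcon ⟨0, by omega⟩ ⟨1, hN⟩ (by simp)
    have h' : ∑ j ∈ symmDiff (positivitySet s y (c ⟨0, by omega⟩))
        (positivitySet s y (c ⟨1, hN⟩)), w j ≤ W :=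
      Finset.sum_le_sum_of_subset_of_nonneg (hHs _ _) fun j hj _ => hw j hj
    nlinarith
  -- The union bound, written with unnormalised weights: if all pairs were far apart, the samples
  -- failing to separate some pair could not exhaust the total mass `W ^ n`.
  have htotal : W ^ n ≤ (N : ℝ) ^ 2 * ((1 - ε) * W) ^ n := by
    calc W ^ n = ∑ f ∈ Fintype.piFinset (fun _ : Fin n => s), ∏ i, w (f i) := by
          rw [← Finset.prod_univ_sum]; simp [hW]
      _ ≤ ∑ f ∈ Fintype.piFinset (fun _ : Fin n => s),
            ∑ q ∈ Q, if f ∈ E q then ∏ i, w (f i) else 0 := by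
          refine Finset.sum_le_sum fun f hf => ?_
          obtain ⟨q, hqQ, hq⟩ := Finset.mem_biUnion.1 (hcover hf)
          refine le_trans (by rw [if_pos hq]) (Finset.single_le_sum
            (f := fun q => if f ∈ E q then ∏ i, w (f i) else 0) (fun q _ => ?_) hqQ)
          split_ifs
          exacts [hprod f hf, le_rfl]
      _ = ∑ q ∈ Q, ∑ f ∈ E q, ∏ i, w (f i) := by
          rw [Finset.sum_comm]
          refine Finset.sum_congr rfl fun q _ => ?_
          rw [Finset.sum_ite_mem, Finset.inter_eq_right.2 (hEsub q)]
      _ ≤ ∑ q ∈ Q, ((1 - ε) * W) ^ n := by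
          refine Finset.sum_le_sum fun q hq => ?_
          rw [← Finset.prod_univ_sum]
          simp only [Finset.prod_const, Finset.card_univ, Fintype.card_fin]
          have h1 := hcon q.1 q.2 (by simpa [Q] using hq)
          have h2 := Finset.sum_sdiff (f := w) (hHs q.1 q.2)
          refine pow_le_pow_left₀ (Finset.sum_nonneg fun j hj =>
            hw j (Finset.mem_sdiff.1 hj).1) ?_ n
          simp only [H] at h2 ⊢
          linarith
      _ ≤ _ := by
          rw [Finset.sum_const, nsmul_eq_mul]
          have h3 : (0 : ℝ) < 1 - ε := by linarith
          refine mul_le_mul_of_nonneg_right ?_ (by positivity)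
          have : Q.card ≤ N ^ 2 := by
            refine (Finset.card_filter_le _ _).trans ?_
            simp [sq]
          exact_mod_cast this
  rw [mul_pow, ← mul_assoc] at htotal
  have hN' : (N : ℝ) = ((n + 1 : ℕ) : ℝ) ^ D + 1 := by rw [hND]; push_cast; rfl
  rw [hN'] at htotal
  have := mul_lt_mul_of_pos_right hn (pow_pos hW0 n)
  linarith

/-- Positivity sets are totally bounded, uniformly over all finite measures on the index set. -/
lemma exists_positivitySet_net (κ ι : Type*) [Fintype κ] [DecidableEq ι] {ε : ℝ} (hε : 0 < ε) :
    ∃ N : ℕ, ∀ (s : Finset ι) (y : ι → κ → ℝ) (w : ι → ℝ), (∀ j ∈ s, 0 ≤ w j) →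
      ∃ F : Finset (Finset ι), F.card ≤ N ∧ (∀ A ∈ F, A ⊆ s) ∧ ∀ c, ∃ A ∈ F,
        ∑ j ∈ symmDiff (positivitySet s y c) A, w j ≤ ε * ∑ j ∈ s, w j := by
  obtain ⟨N, hN⟩ := exists_packing_bound κ ι hε
  refine ⟨N, fun s y w hw => ?_⟩
  let S : ℕ → Prop := fun n => ∃ c : Fin n → κ → ℝ, ∀ a b, a ≠ b → ε * ∑ j ∈ s, w j <
    ∑ j ∈ symmDiff (positivitySet s y (c a)) (positivitySet s y (c b)), w j
  have hex : ∃ n, ¬ S n := ⟨N, fun ⟨c, hc⟩ => by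
    obtain ⟨a, b, hab, h⟩ := hN s y w hw c
    exact absurd (hc a b hab) (not_lt.2 h)⟩
  classical
  have hfind := Nat.find_spec hex
  have hle : Nat.find hex ≤ N := Nat.find_min' hex fun ⟨c, hc⟩ => by
    obtain ⟨a, b, hab, h⟩ := hN s y w hw c
    exact absurd (hc a b hab) (not_lt.2 h)
  -- The empty family is separated, so the first impossible size is a successor. A separated family
  -- of the preceding size cannot be extended, hence is a net.
  obtain ⟨n, hn⟩ : ∃ n, Nat.find hex = n + 1 := Nat.exists_eq_succ_of_ne_zero fun h0 => by
    rw [h0] at hfind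
    exact hfind ⟨fun a => a.elim0, fun a => a.elim0⟩
  obtain ⟨c, hc⟩ : S n := not_not.1 (Nat.find_min hex (by omega))
  rw [hn] at hfind hle
  refine ⟨Finset.univ.image fun a => positivitySet s y (c a), ?_, ?_, fun c' => ?_⟩
  · refine Finset.card_image_le.trans ?_
    simp; omega
  · intro A hA
    obtain ⟨a, -, rfl⟩ := Finset.mem_image.1 hA
    exact positivitySet_subset _ _ _
  · by_contra! hcon
    refine hfind ⟨Fin.cons c' c, fun a b hab => ?_⟩
    have hfar : ∀ a, ε * ∑ j ∈ s, w j <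
        ∑ j ∈ symmDiff (positivitySet s y c') (positivitySet s y (c a)), w j := fun a =>
      hcon _ (Finset.mem_image_of_mem _ (Finset.mem_univ a))
    induction a using Fin.cases with
    | zero =>
      induction b using Fin.cases with
      | zero => exact absurd rfl hab
      | succ b => simpa using hfar b
    | succ a =>
      induction b using Fin.cases with
      | zero => simpa [symmDiff_comm] using hfar a
      | succ b => simpa using hc a b fun h => hab (by rw [h])

end PositivitySet

/-! ### From level sets to exponential weights -/

section LayerCake

/-- The lower Riemann sum with mesh `h` of the layer-cake formula for `f`, with `J` layers. -/
lemma layerSum_bounds {h f : ℝ} (hh : 0 < h) (hf : 0 ≤ f) (J : ℕ) :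
    (J * h < f → ∑ l ∈ Finset.range J, (if (l + 1) * h < f then h else 0) = J * h) ∧
    (f ≤ J * h → f - h ≤ ∑ l ∈ Finset.range J, (if (l + 1) * h < f then h else 0) ∧
      ∑ l ∈ Finset.range J, (if (l + 1) * h < f then h else 0) ≤ f) := by
  induction J with
  | zero => simp only [Nat.cast_zero, zero_mul, Finset.range_zero, Finset.sum_empty]
            exact ⟨fun _ => trivial, fun h => ⟨by linarith, hf⟩⟩
  | succ J ih =>
    rw [Finset.sum_range_succ]
    push_cast
    constructor
    · intro hJ
      rw [ih.1 (by nlinarith), if_pos hJ]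
      ring
    · intro hJ
      rw [if_neg (not_lt.2 hJ), add_zero]
      by_cases hJ' : J * h < f
      · rw [ih.1 hJ']
        constructor <;> linarith
      · exact ih.2 (not_lt.1 hJ')

/-- Below the cap L the error is at most the mesh; above it, f itself is at most f²/L. -/
lemma abs_sub_layerSum_le {L f : ℝ} (hL : 0 < L) (hf : 0 ≤ f) {J : ℕ} (hJ : 0 < J) :
    |f - ∑ l ∈ Finset.range J, (if (l + 1) * (L / J) < f then L / J else 0)|
      ≤ L / J + f ^ 2 / L := by
  have hJ' : (0 : ℝ) < J := by exact_mod_cast hJ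
  have hh : 0 < L / J := by positivity
  have hJL : J * (L / J) = L := by field_simp
  have hq : 0 ≤ f ^ 2 / L := by positivity
  obtain ⟨h1, h2⟩ := layerSum_bounds hh hf J
  rw [hJL] at h1 h2
  by_cases hfL : L < f
  · rw [h1 hfL, abs_of_nonneg (by linarith)]
    have : f ≤ f ^ 2 / L := by
      rw [le_div_iff₀ hL]; nlinarith
    linarith
  · obtain ⟨h3, h4⟩ := h2 (not_lt.1 hfL)
    rw [abs_of_nonneg (by linarith)]
    linarith

variable {ι : Type*}

/-- The layer sum replaces f by J level sets, each weighted L/J and each controlled by δ. Mesh error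
and overshoot above L are paid for by the second moments of a and of a·f. -/
lemma abs_sum_mul_le_of_levelSets (s : Finset ι) (a f ξ : ι → ℝ) {K A L δ k : ℝ} {J : ℕ}
    (hJ : 0 < J) (hL : 0 < L) (hK : 0 ≤ K) (ha : ∀ j ∈ s, 0 ≤ a j) (hf : ∀ j ∈ s, 0 ≤ f j)
    (hξ : ∀ j ∈ s, |ξ j| ≤ K * a j) (haf : ∑ j ∈ s, a j ^ 2 * f j ^ 2 ≤ k)
    (haA : ∑ j ∈ s, a j ^ 2 ≤ A * k)
    (hlev : ∀ u : ℝ, 0 < u → |∑ j ∈ s with u < f j, a j * ξ j| ≤ δ * k) :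
    |∑ j ∈ s, a j * ξ j * f j| ≤ (K * A * L / J + L * δ + K / L) * k := by
  have hJ' : (0 : ℝ) < J := by exact_mod_cast hJ
  set g : ι → ℝ := fun j => ∑ l ∈ Finset.range J, (if (l + 1) * (L / J) < f j then L / J else 0)
    with hg
  have hsplit : ∑ j ∈ s, a j * ξ j * f j
      = ∑ j ∈ s, a j * ξ j * g j + ∑ j ∈ s, a j * ξ j * (f j - g j) := by
    rw [← Finset.sum_add_distrib]
    exact Finset.sum_congr rfl fun j _ => by ring
  have h1 : |∑ j ∈ s, a j * ξ j * g j| ≤ L * δ * k := by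
    have : ∑ j ∈ s, a j * ξ j * g j = ∑ l ∈ Finset.range J,
        L / J * ∑ j ∈ s with (l + 1) * (L / J) < f j, a j * ξ j := by
      simp only [hg, Finset.mul_sum]
      rw [Finset.sum_comm]
      refine Finset.sum_congr rfl fun l _ => ?_
      rw [Finset.sum_filter]
      refine Finset.sum_congr rfl fun j _ => ?_
      split_ifs <;> ring
    rw [this]
    calc _ ≤ ∑ l ∈ Finset.range J, L / J * (δ * k) := by
          refine (Finset.abs_sum_le_sum_abs _ _).trans (Finset.sum_le_sum fun l _ => ?_)
          rw [abs_mul, abs_of_nonneg (by positivity : 0 ≤ L / J)]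
          exact mul_le_mul_of_nonneg_left (hlev _ (by positivity)) (by positivity)
      _ = _ := by
          rw [Finset.sum_const, Finset.card_range, nsmul_eq_mul]
          field_simp
  have h2 : |∑ j ∈ s, a j * ξ j * (f j - g j)| ≤ (K * A * L / J + K / L) * k := by
    calc _ ≤ ∑ j ∈ s, (K * (L / J) * a j ^ 2 + K / L * (a j ^ 2 * f j ^ 2)) := by
          refine (Finset.abs_sum_le_sum_abs _ _).trans (Finset.sum_le_sum fun j hj => ?_)
          rw [abs_mul, abs_mul, abs_of_nonneg (ha j hj)]
          have h3 := abs_sub_layerSum_le hL (hf j hj) hJ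
          have h4 : a j * |ξ j| ≤ a j * (K * a j) :=
            mul_le_mul_of_nonneg_left (hξ j hj) (ha j hj)
          calc _ ≤ a j * (K * a j) * (L / J + f j ^ 2 / L) :=
                mul_le_mul h4 h3 (abs_nonneg _) ((mul_nonneg (ha j hj) (abs_nonneg _)).trans h4)
            _ = _ := by field_simp
      _ = K * (L / J) * ∑ j ∈ s, a j ^ 2 + K / L * ∑ j ∈ s, a j ^ 2 * f j ^ 2 := by
          rw [Finset.sum_add_distrib, Finset.mul_sum, Finset.mul_sum]
      _ ≤ K * (L / J) * (A * k) + K / L * k := by gcongr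
      _ = _ := by ring
  rw [hsplit]
  refine (abs_add_le _ _).trans ((add_le_add h1 h2).trans (le_of_eq (by ring)))

/-- The coordinates in which the level sets of `exp (x j ⬝ᵥ b) / a j` are positivity sets. -/
noncomputable def levelCoords {p : ℕ} (x : ι → Fin p → ℝ) (a : ι → ℝ) :
    ι → Fin p ⊕ Fin 2 → ℝ :=
  fun j => Sum.elim (x j) ![-Real.log (a j), 1]

/-- The point is that δ depends on K, A, ε alone: the bound holds for all b and designs because the
level-set hypothesis covers every half-space. -/
lemma exists_abs_sum_exp_le {p : ℕ} {K A ε : ℝ} (hK : 0 ≤ K) (hA : 0 ≤ A) (hε : 0 < ε) :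
    ∃ δ > 0, ∀ (s : Finset ι) (x : ι → Fin p → ℝ) (a ξ : ι → ℝ) (b : Fin p → ℝ) (k R : ℝ),
      0 < k → 0 < R → (∀ j ∈ s, 0 < a j) → (∀ j ∈ s, |ξ j| ≤ K * a j) →
      ∑ j ∈ s, a j ^ 2 ≤ A * k → ∑ j ∈ s, Real.exp (x j ⬝ᵥ b) ^ 2 ≤ R ^ 2 →
      (∀ c, |∑ j ∈ positivitySet s (levelCoords x a) c, a j * ξ j| ≤ δ * k) →
      |∑ j ∈ s, ξ j * Real.exp (x j ⬝ᵥ b)| ≤ ε * (Real.sqrt k * R) := by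
  obtain ⟨L, hL, hKL⟩ : ∃ L : ℝ, 0 < L ∧ K / L ≤ ε / 3 :=
    ⟨(3 * K + 1) / ε, by positivity, by
      rw [div_div_eq_mul_div, div_le_div_iff₀ (by positivity) (by norm_num)]; nlinarith⟩
  obtain ⟨J, hJ⟩ := exists_nat_gt (3 * (K * A * L) / ε)
  have hJ0 : (0 : ℝ) < J := lt_of_le_of_lt (by positivity) hJ
  refine ⟨ε / (3 * L), by positivity, fun s x a ξ b k R hk hR ha hξ haA hm hc => ?_⟩
  -- This normalisation makes f = r exp(x·b)/a satisfy Σ a² f² ≤ k, whatever the size of b.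
  set r := Real.sqrt k / R with hr
  have hk' : 0 < Real.sqrt k := Real.sqrt_pos.2 hk
  have hr0 : 0 < r := by positivity
  have main := abs_sum_mul_le_of_levelSets (δ := ε / (3 * L)) (k := k) (A := A) (K := K) s a
    (fun j => r * Real.exp (x j ⬝ᵥ b) / a j) ξ
    (by exact_mod_cast hJ0) hL hK (fun j hj => (ha j hj).le)
    (fun j hj => by have := ha j hj; positivity) hξ ?_ haA ?_
  · have h1 : ∑ j ∈ s, a j * ξ j * (r * Real.exp (x j ⬝ᵥ b) / a j)
        = r * ∑ j ∈ s, ξ j * Real.exp (x j ⬝ᵥ b) := by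
      rw [Finset.mul_sum]
      refine Finset.sum_congr rfl fun j hj => ?_
      have := (ha j hj).ne'
      field_simp
    rw [h1, abs_mul, abs_of_pos hr0] at main
    have h2 : K * A * L / J ≤ ε / 3 := by
      rw [div_lt_iff₀ hε] at hJ
      rw [div_le_iff₀ hJ0]; linarith
    have h3 : L * (ε / (3 * L)) = ε / 3 := by field_simp
    have h4 : r * |∑ j ∈ s, ξ j * Real.exp (x j ⬝ᵥ b)| ≤ ε * k :=
      main.trans (mul_le_mul_of_nonneg_right (by linarith) hk.le)
    have h5 : ε * k = r * (ε * (Real.sqrt k * R)) := by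
      rw [hr]; field_simp; rw [Real.sq_sqrt hk.le]
    rw [h5] at h4
    exact le_of_mul_le_mul_left h4 hr0
  · calc _ = r ^ 2 * ∑ j ∈ s, Real.exp (x j ⬝ᵥ b) ^ 2 := by
          rw [Finset.mul_sum]
          refine Finset.sum_congr rfl fun j hj => ?_
          have := (ha j hj).ne'
          field_simp
      _ ≤ r ^ 2 * R ^ 2 := by gcongr
      _ = k := by rw [hr]; field_simp; rw [Real.sq_sqrt hk.le]
  · intro u hu
    -- Taking logarithms, u < r exp(x·b)/a reads x·b − log a + log r − log u > 0, a half-space in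
    -- `levelCoords`.
    refine le_of_eq_of_le ?_ (hc (Sum.elim b ![1, Real.log r - Real.log u]))
    congr 1
    refine Finset.sum_congr ?_ fun _ _ => rfl
    ext j
    simp only [Finset.mem_filter, mem_positivitySet, and_congr_right_iff]
    intro hj
    have hy : levelCoords x a j ⬝ᵥ Sum.elim b ![1, Real.log r - Real.log u]
        = x j ⬝ᵥ b - Real.log (a j) + (Real.log r - Real.log u) := by
      rw [levelCoords, sumElim_dotProduct_sumElim]
      simp [dotProduct, Fin.sum_univ_two]
      ring
    have haj := ha j hj
    rw [hy, ← Real.log_lt_log_iff hu (by positivity), Real.log_div (by positivity) haj.ne',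
      Real.log_mul hr0.ne' (by positivity), Real.log_exp]
    constructor <;> intro h <;> linarith

end LayerCake

/-! ### Weak laws at a moderate scale, pointwise and over half-spaces -/

section UniformLaw

variable {Ω : Type*} [MeasurableSpace Ω] {P : Measure Ω}

lemma tendsto_measure_zero_of_forall {B : ℕ → Set Ω}
    (h : ∀ η : ℝ, 0 < η → ∀ᶠ k in atTop, P (B k) ≤ ENNReal.ofReal η) :
    Tendsto (fun k => P (B k)) atTop (𝓝 0) := by
  rw [ENNReal.tendsto_nhds_zero]
  intro ε hε
  by_cases hε' : ε = ⊤
  · simp [hε']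
  · have := h ε.toReal (ENNReal.toReal_pos hε.ne' hε')
    rwa [ENNReal.ofReal_toReal hε'] at this

lemma tendsto_measure_zero_mono {B C : ℕ → Set Ω} (hC : Tendsto (fun k => P (C k)) atTop (𝓝 0))
    (h : ∀ᶠ k in atTop, B k ⊆ C k) : Tendsto (fun k => P (B k)) atTop (𝓝 0) :=
  tendsto_of_tendsto_of_tendsto_of_le_of_le' tendsto_const_nhds hC
    (Eventually.of_forall fun _ => zero_le) (h.mono fun _ hk => measure_mono hk)

lemma tendsto_measure_zero_union {B C : ℕ → Set Ω}
    (hB : Tendsto (fun k => P (B k)) atTop (𝓝 0)) (hC : Tendsto (fun k => P (C k)) atTop (𝓝 0)) :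
    Tendsto (fun k => P (B k ∪ C k)) atTop (𝓝 0) := by
  have := hB.add hC
  rw [add_zero] at this
  exact tendsto_of_tendsto_of_tendsto_of_le_of_le tendsto_const_nhds this
    (fun _ => zero_le) fun _ => measure_union_le _ _

variable [IsProbabilityMeasure P]

lemma measure_abs_centered_sum_ge_le {X : ℕ → Ω → ℝ} (hX : ∀ i, MemLp (X i) 2 P)
    (hind : Pairwise fun i j => IndepFun (X i) (X j) P) (s : Finset ℕ) (d : ℕ → ℝ) {r : ℝ}
    (hr : 0 < r) :
    P {ω | r ≤ |∑ i ∈ s, d i * (X i ω - ∫ ω', X i ω' ∂P)|} ≤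
      ENNReal.ofReal ((∑ i ∈ s, d i ^ 2 * Var[X i; P]) / r ^ 2) := by
  have hdX : ∀ i ∈ s, MemLp (fun ω => d i * X i ω) 2 P := fun i _ => (hX i).const_mul (d i)
  have hvar : Var[∑ i ∈ s, fun ω => d i * X i ω; P] = ∑ i ∈ s, d i ^ 2 * Var[X i; P] := by
    rw [IndepFun.variance_sum hdX]
    · exact Finset.sum_congr rfl fun i _ => variance_const_mul _ _ _
    · intro i _ j _ hij
      exact (hind hij).comp (measurable_const_mul (d i)) (measurable_const_mul (d j))
  have hmem : MemLp (∑ i ∈ s, fun ω => d i * X i ω) 2 P := memLp_finsetSum' _ hdX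
  have h := meas_ge_le_variance_div_sq hmem hr
  rw [hvar] at h
  refine le_of_eq_of_le ?_ h
  congr 1
  ext ω
  simp only [Set.mem_ofPred_eq, Finset.sum_apply]
  rw [integral_finsetSum _ fun i hi => (hdX i hi).integrable one_le_two]
  rw [← Finset.sum_sub_distrib]
  simp only [integral_const_mul, mul_sub]

lemma variance_le_sq_of_abs_le {X : Ω → ℝ} (hX : AEMeasurable X P) {r : ℝ}
    (h : ∀ ω, |X ω| ≤ r) : Var[X; P] ≤ r ^ 2 := by
  have := variance_le_sq_of_bounded (μ := P) (a := -r) (b := r) (X := X)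
    (ae_of_all _ fun ω => abs_le.1 (h ω)) hX
  refine this.trans (le_of_eq (by ring))

/-- The pairs `(i, t)` with `i < k`. -/
def observations (T : ℕ → ℕ) (k : ℕ) : Finset ((i : ℕ) × Fin (T i)) :=
  (Finset.range k).sigma fun _ => Finset.univ

lemma sum_observations (T : ℕ → ℕ) (k : ℕ) (f : (i : ℕ) × Fin (T i) → ℝ) :
    ∑ j ∈ observations T k, f j = ∑ i ∈ Finset.range k, ∑ t, f ⟨i, t⟩ :=
  Finset.sum_sigma _ _ _

lemma sum_fst_eq_sum_card {T : ℕ → ℕ} {k : ℕ} {A : Finset ((i : ℕ) × Fin (T i))}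
    (hA : A ⊆ observations T k) (g : ℕ → ℝ) :
    ∑ j ∈ A, g j.1 = ∑ i ∈ Finset.range k, (A.filter fun j => j.1 = i).card * g i := by
  rw [← Finset.sum_fiberwise_of_maps_to (s := A) (t := Finset.range k) (g := fun j => j.1)
    (fun j hj => (Finset.mem_sigma.1 (hA hj)).1)]
  refine Finset.sum_congr rfl fun i _ => ?_
  rw [Finset.sum_congr rfl (g := fun _ => g i), Finset.sum_const, nsmul_eq_mul]
  intro j hj
  rw [(Finset.mem_filter.1 hj).2]

lemma card_fiber_le {T : ℕ → ℕ} {m : ℕ} (hT : ∀ i, T i ≤ m)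
    (A : Finset ((i : ℕ) × Fin (T i))) (i : ℕ) : (A.filter fun j => j.1 = i).card ≤ m := by
  classical
  refine le_trans ?_ (hT i)
  calc _ ≤ ((Finset.univ : Finset (Fin (T i))).map ⟨fun t => (⟨i, t⟩ : (i : ℕ) × Fin (T i)),
        fun t t' h => by simpa using h⟩).card := by
        refine Finset.card_le_card fun j hj => ?_
        obtain ⟨j1, j2⟩ := j
        obtain rfl : j1 = i := (Finset.mem_filter.1 hj).2
        exact Finset.mem_map.2 ⟨j2, Finset.mem_univ _, rfl⟩
    _ = T i := by simp

/-- The growth of the scales `a i` of the individual terms: their squares have bounded averages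
and are individually negligible. -/
structure ModerateScale (a : ℕ → ℝ) (A : ℝ) : Prop where
  one_le : ∀ i, 1 ≤ a i
  sum_sq_le : ∀ k : ℕ, ∑ i ∈ Finset.range k, a i ^ 2 ≤ A * k
  sum_pow_four : Tendsto (fun k : ℕ => (∑ i ∈ Finset.range k, a i ^ 4) / (k : ℝ) ^ 2) atTop (𝓝 0)

lemma ModerateScale.nonneg {a : ℕ → ℝ} {A : ℝ} (h : ModerateScale a A) : 0 ≤ A := by
  have h1 := h.sum_sq_le 1
  simp at h1
  nlinarith [sq_nonneg (a 0)]

/-- If the variances are `O(a i ^ 4)` then the centred sums are `o(k)` in probability. -/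
lemma tendsto_measure_abs_centered_sum_ge {a : ℕ → ℝ} {A : ℝ} (ha : ModerateScale a A)
    {X : ℕ → Ω → ℝ} (hX : ∀ i, MemLp (X i) 2 P)
    (hind : Pairwise fun i j => IndepFun (X i) (X j) P) {C : ℝ}
    (hvar : ∀ i, Var[X i; P] ≤ C * a i ^ 4) {ε : ℝ} (hε : 0 < ε) :
    Tendsto (fun k : ℕ => P {ω | ε * k ≤ |∑ i ∈ Finset.range k, (X i ω - ∫ ω', X i ω' ∂P)|})
      atTop (𝓝 0) := by
  have hlim : Tendsto (fun k : ℕ => ENNReal.ofReal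
      (C / ε ^ 2 * ((∑ i ∈ Finset.range k, a i ^ 4) / (k : ℝ) ^ 2))) atTop (𝓝 0) := by
    have := ENNReal.tendsto_ofReal (ha.sum_pow_four.const_mul (C / ε ^ 2))
    simpa using this
  refine tendsto_of_tendsto_of_tendsto_of_le_of_le' tendsto_const_nhds hlim
    (Eventually.of_forall fun _ => zero_le) ?_
  filter_upwards [eventually_gt_atTop 0] with k hk
  have hk' : (0 : ℝ) < k := by exact_mod_cast hk
  have h := measure_abs_centered_sum_ge_le hX hind (Finset.range k) (fun _ => 1)
    (mul_pos hε hk')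
  simp only [one_mul, one_pow] at h
  refine h.trans (ENNReal.ofReal_le_ofReal ?_)
  rw [div_mul_div_comm, Finset.mul_sum, mul_pow]
  gcongr with i _
  exact hvar i

/-- A weighted Glivenko–Cantelli law over positivity sets. -/
lemma tendsto_measure_exists_positivitySet {T : ℕ → ℕ} {m : ℕ} (hT : ∀ i, T i ≤ m)
    {κ : Type*} [Fintype κ] (y : (i : ℕ) × Fin (T i) → κ → ℝ)
    {a : ℕ → ℝ} {A : ℝ} (ha : ModerateScale a A) {X : ℕ → Ω → ℝ} (hX : ∀ i, MemLp (X i) 2 P)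
    (hind : Pairwise fun i j => IndepFun (X i) (X j) P) {K : ℝ} (hK : 0 ≤ K)
    (hvar : ∀ i, Var[X i; P] ≤ K ^ 2 * a i ^ 2)
    (hbdd : ∀ i ω, |X i ω - ∫ ω', X i ω' ∂P| ≤ K * a i) {δ : ℝ} (hδ : 0 < δ) :
    Tendsto (fun k : ℕ => P {ω | ∃ c, δ * k < |∑ j ∈ positivitySet (observations T k) y c,
      a j.1 * (X j.1 ω - ∫ ω', X j.1 ω' ∂P)|}) atTop (𝓝 0) := by
  classical
  have hA := ha.nonneg
  -- With total weight at most m A k, passing to the nearest member of the net costs at most δk/2.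
  set ρ := δ / (2 * (K * (m * A) + 1)) with hρ
  have hden : 0 < K * (m * A) + 1 := by positivity
  have hρ0 : 0 < ρ := by positivity
  obtain ⟨N, hN⟩ := exists_positivitySet_net κ ((i : ℕ) × Fin (T i)) hρ0
  have hlim : Tendsto (fun k : ℕ => ENNReal.ofReal (N * (m ^ 2 * K ^ 2 * 4 / δ ^ 2 *
      ((∑ i ∈ Finset.range k, a i ^ 4) / (k : ℝ) ^ 2)))) atTop (𝓝 0) := by
    have := ENNReal.tendsto_ofReal
      ((ha.sum_pow_four.const_mul (m ^ 2 * K ^ 2 * 4 / δ ^ 2)).const_mul (N : ℝ))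
    simpa using this
  refine tendsto_of_tendsto_of_tendsto_of_le_of_le' tendsto_const_nhds hlim
    (Eventually.of_forall fun _ => zero_le) ?_
  filter_upwards [eventually_gt_atTop 0] with k hk
  have hk' : (0 : ℝ) < k := by exact_mod_cast hk
  obtain ⟨F, hFN, hFs, hF⟩ := hN (observations T k) y (fun j => a j.1 ^ 2)
    fun j _ => sq_nonneg _
  have htot : ∑ j ∈ observations T k, a j.1 ^ 2 ≤ m * A * k := by
    rw [sum_observations]
    calc _ ≤ ∑ i ∈ Finset.range k, m * a i ^ 2 := by
          refine Finset.sum_le_sum fun i _ => ?_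
          simp only [Finset.sum_const, Finset.card_univ, Fintype.card_fin, nsmul_eq_mul]
          have : (T i : ℝ) ≤ m := by exact_mod_cast hT i
          gcongr
      _ ≤ m * (A * k) := by
          rw [← Finset.mul_sum]
          exact mul_le_mul_of_nonneg_left (ha.sum_sq_le k) (by positivity)
      _ = _ := by ring
  let Z : (i : ℕ) × Fin (T i) → Ω → ℝ := fun j ω => a j.1 * (X j.1 ω - ∫ ω', X j.1 ω' ∂P)
  have hZ : ∀ j ω, |Z j ω| ≤ K * a j.1 ^ 2 := by
    intro j ω
    have h1 := ha.one_le j.1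
    simp only [Z, abs_mul, abs_of_pos (zero_lt_one.trans_le h1)]
    calc _ ≤ a j.1 * (K * a j.1) := by gcongr; exact hbdd _ _
      _ = _ := by ring
  have hcover : {ω | ∃ c, δ * k < |∑ j ∈ positivitySet (observations T k) y c, Z j ω|} ⊆
      ⋃ B ∈ F, {ω | δ / 2 * k ≤ |∑ j ∈ B, Z j ω|} := by
    rintro ω ⟨c, hc⟩
    obtain ⟨B, hB, hw⟩ := hF c
    simp only [Set.mem_iUnion]
    refine ⟨B, hB, ?_⟩
    set H := positivitySet (observations T k) y c with hH
    have hdiff : |∑ j ∈ H, Z j ω - ∑ j ∈ B, Z j ω| ≤ ∑ j ∈ symmDiff H B, K * a j.1 ^ 2 := by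
      rw [← Finset.sum_sdiff_sub_sum_sdiff, show symmDiff H B = H \ B ∪ B \ H from rfl,
        Finset.sum_union disjoint_sdiff_sdiff]
      refine (abs_sub _ _).trans (add_le_add ?_ ?_) <;>
      exact (Finset.abs_sum_le_sum_abs _ _).trans (Finset.sum_le_sum fun j _ => hZ j ω)
    have hsmall : ∑ j ∈ symmDiff H B, K * a j.1 ^ 2 ≤ δ / 2 * k := by
      rw [← Finset.mul_sum]
      calc _ ≤ K * (ρ * (m * A * k)) := by
            refine mul_le_mul_of_nonneg_left (hw.trans ?_) hK
            exact mul_le_mul_of_nonneg_left htot hρ0.le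
        _ = ρ * (K * (m * A)) * k := by ring
        _ ≤ ρ * (K * (m * A) + 1) * k := by gcongr; linarith
        _ = _ := by rw [hρ]; field_simp
    have := abs_sub_abs_le_abs_sub (∑ j ∈ H, Z j ω) (∑ j ∈ B, Z j ω)
    simp only [Set.mem_ofPred_eq]
    linarith
  refine (measure_mono hcover).trans ((measure_biUnion_finset_le _ _).trans ?_)
  -- Grouping by individual restores pairwise independent summands; each individual occurs at most m
  -- times in `B`.
  have heach : ∀ B ∈ F, P {ω | δ / 2 * k ≤ |∑ j ∈ B, Z j ω|} ≤ ENNReal.ofReal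
      (m ^ 2 * K ^ 2 * 4 / δ ^ 2 * ((∑ i ∈ Finset.range k, a i ^ 4) / (k : ℝ) ^ 2)) := by
    intro B hB
    have h := measure_abs_centered_sum_ge_le hX hind (Finset.range k)
      (fun i => (B.filter fun j => j.1 = i).card * a i) (r := δ / 2 * k) (by positivity)
    have heq : ∀ ω, ∑ j ∈ B, Z j ω = ∑ i ∈ Finset.range k,
        (B.filter fun j => j.1 = i).card * a i * (X i ω - ∫ ω', X i ω' ∂P) := by
      intro ω
      simp only [mul_assoc]
      exact sum_fst_eq_sum_card (hFs B hB) fun i => a i * (X i ω - ∫ ω', X i ω' ∂P)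
    simp only [heq]
    refine h.trans (ENNReal.ofReal_le_ofReal ?_)
    rw [div_mul_div_comm, div_le_div_iff₀ (by positivity) (by positivity)]
    have h1 : ∑ i ∈ Finset.range k, ((B.filter fun j => j.1 = i).card * a i) ^ 2 * Var[X i; P]
        ≤ m ^ 2 * K ^ 2 * ∑ i ∈ Finset.range k, a i ^ 4 := by
      rw [Finset.mul_sum]
      refine Finset.sum_le_sum fun i _ => ?_
      have hc : ((B.filter fun j => j.1 = i).card : ℝ) ≤ m := by
        exact_mod_cast card_fiber_le hT B i
      have ha0 : 0 ≤ a i := zero_le_one.trans (ha.one_le i)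
      calc _ ≤ (m * a i) ^ 2 * (K ^ 2 * a i ^ 2) := by
            gcongr
            · exact variance_nonneg _ _
            · exact hvar i
        _ = _ := by ring
    calc _ ≤ (m ^ 2 * K ^ 2 * ∑ i ∈ Finset.range k, a i ^ 4) * (δ ^ 2 * (k : ℝ) ^ 2) := by gcongr
      _ = _ := by ring
  calc _ ≤ ∑ B ∈ F, ENNReal.ofReal
        (m ^ 2 * K ^ 2 * 4 / δ ^ 2 * ((∑ i ∈ Finset.range k, a i ^ 4) / (k : ℝ) ^ 2)) :=
        Finset.sum_le_sum heach
    _ ≤ _ := by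
        rw [Finset.sum_const, nsmul_eq_mul, ENNReal.ofReal_mul (Nat.cast_nonneg N),
          ENNReal.ofReal_natCast]
        gcongr

end UniformLaw

/-! ### Truncation of uniformly integrable counts -/

section Truncation

variable {Ω : Type*} [MeasurableSpace Ω] {P : Measure Ω}

/-- The counts `S i` are square integrable, pairwise independent, and the normalised squares
`(S i / a i) ^ 2` are uniformly integrable. -/
structure UniformlyIntegrableCounts (P : Measure Ω) (S : ℕ → Ω → ℕ) (a : ℕ → ℝ) : Prop where
  measurable : ∀ i, Measurable (S i)
  memLp : ∀ i, MemLp (fun ω => (S i ω : ℝ)) 2 P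
  indep : Pairwise fun i j => IndepFun (S i) (S j) P
  tail : ∀ ε : ℝ, 0 < ε → ∃ K : ℝ, 0 < K ∧ ∀ i,
    ∫ ω in {ω | K * a i < S i ω}, (S i ω : ℝ) ^ 2 ∂P ≤ ε * a i ^ 2

/-- The part of a count that does not exceed `r`. -/
noncomputable def truncatedCount (r : ℝ) (n : ℕ) : ℝ := if (n : ℝ) ≤ r then (n : ℝ) else 0

lemma truncatedCount_nonneg (r : ℝ) (n : ℕ) : 0 ≤ truncatedCount r n := by
  unfold truncatedCount; split_ifs <;> simp

lemma truncatedCount_le {r : ℝ} (hr : 0 ≤ r) (n : ℕ) : truncatedCount r n ≤ r := by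
  unfold truncatedCount; split_ifs <;> simp_all

lemma truncatedCount_le_self (r : ℝ) (n : ℕ) : truncatedCount r n ≤ n := by
  unfold truncatedCount; split_ifs <;> simp

lemma measurable_truncatedCount (r : ℝ) : Measurable (truncatedCount r) := measurable_of_countable _

lemma sub_truncatedCount_sq (r : ℝ) (n : ℕ) :
    ((n : ℝ) - truncatedCount r n) ^ 2 = if r < n then (n : ℝ) ^ 2 else 0 := by
  unfold truncatedCount
  by_cases h : (n : ℝ) ≤ r
  · rw [if_pos h, if_neg (not_lt.2 h)]; simp
  · rw [if_neg h, if_pos (not_le.1 h)]; simp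

/-- Integrality matters: n² − n ≥ 0 for a natural number, so replacing a large count by 0 can only
lower n² − n, and by no more than n². -/
lemma truncatedCount_mul_pred_bounds (r : ℝ) (n : ℕ) :
    truncatedCount r n ^ 2 - truncatedCount r n ≤ (n : ℝ) ^ 2 - n ∧
    (n : ℝ) ^ 2 - n ≤ truncatedCount r n ^ 2 - truncatedCount r n +
      ((n : ℝ) - truncatedCount r n) ^ 2 ∧ 0 ≤ truncatedCount r n ^ 2 - truncatedCount r n := by
  have hn : (0 : ℝ) ≤ (n : ℝ) ^ 2 - n := by
    rcases Nat.eq_zero_or_pos n with h | h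
    · simp [h]
    · have : (1 : ℝ) ≤ n := by exact_mod_cast h
      nlinarith
  unfold truncatedCount
  split_ifs with h
  · simp [hn]
  · simp only [ne_eq, OfNat.ofNat_ne_zero, not_false_eq_true, zero_pow, sub_zero, hn, zero_add,
      tsub_le_iff_right, le_add_iff_nonneg_right, Nat.cast_nonneg, le_refl, and_self]

lemma integral_sub_truncatedCount_sq {S : Ω → ℕ} (hS : Measurable S) (r : ℝ) :
    ∫ ω, ((S ω : ℝ) - truncatedCount r (S ω)) ^ 2 ∂P
      = ∫ ω in {ω | r < S ω}, (S ω : ℝ) ^ 2 ∂P := by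
  have hm : MeasurableSet {ω | r < (S ω : ℝ)} := hS (MeasurableSet.of_discrete (s := {n : ℕ | r < n}))
  rw [← integral_indicator hm]
  congr 1
  ext ω
  rw [sub_truncatedCount_sq]
  simp [Set.indicator_apply]

variable [IsProbabilityMeasure P]

lemma memLp_truncatedCount {S : Ω → ℕ} (hS : Measurable S) {r : ℝ} (hr : 0 ≤ r) :
    MemLp (fun ω => truncatedCount r (S ω)) 2 P := by
  refine MemLp.of_bound ((measurable_truncatedCount r).comp hS).aestronglyMeasurable r
    (ae_of_all _ fun ω => ?_)
  rw [Real.norm_of_nonneg (truncatedCount_nonneg _ _)]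
  exact truncatedCount_le hr _

/-- The sum of the fitted means of individual `i`. -/
noncomputable def totalRate {p : ℕ} {T : ℕ → ℕ} (x : (i : ℕ) → Fin (T i) → Fin p → ℝ)
    (b : Fin p → ℝ) (i : ℕ) : ℝ := ∑ t, (poissonRate (x i t) b : ℝ)

lemma totalRate_nonneg {p : ℕ} {T : ℕ → ℕ} (x : (i : ℕ) → Fin (T i) → Fin p → ℝ)
    (b : Fin p → ℝ) (i : ℕ) : 0 ≤ totalRate x b i :=
  Finset.sum_nonneg fun _ _ => NNReal.coe_nonneg _

lemma measure_lt_sum_ofReal_le {f : ℕ → Ω → ℝ} {k : ℕ} (hf : ∀ i, Integrable (f i) P)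
    (hf0 : ∀ i ω, 0 ≤ f i ω) {B r : ℝ} (hr : 0 < r)
    (hB : ∑ i ∈ Finset.range k, ∫ ω, f i ω ∂P ≤ B) :
    P {ω | r < ∑ i ∈ Finset.range k, f i ω} ≤ ENNReal.ofReal (B / r) := by
  have h1 := mul_meas_ge_le_integral_of_nonneg (μ := P)
    (f := fun ω => ∑ i ∈ Finset.range k, f i ω)
    (ae_of_all _ fun ω => Finset.sum_nonneg fun i _ => hf0 i ω)
    (integrable_finsetSum _ fun i _ => hf i) r
  rw [integral_finsetSum _ fun i _ => hf i] at h1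
  rw [← ofReal_measureReal]
  refine ENNReal.ofReal_le_ofReal ?_
  rw [le_div_iff₀ hr, mul_comm]
  refine le_trans (mul_le_mul_of_nonneg_left (measureReal_mono ?_) hr.le) (h1.trans hB)
  intro ω hω
  simp only [Set.mem_ofPred_eq] at hω ⊢
  exact hω.le

/-- Uniformly in the parameter, the observed counts correlate with the fitted means at most as
much as their expectations do, up to a negligible error. -/
lemma tendsto_measure_exists_correlation {p : ℕ} {T : ℕ → ℕ} {m : ℕ} (hT : ∀ i, T i ≤ m)
    (x : (i : ℕ) → Fin (T i) → Fin p → ℝ) {a : ℕ → ℝ} {A : ℝ} (ha : ModerateScale a A)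
    {S : ℕ → Ω → ℕ} (hS : UniformlyIntegrableCounts P S a) {ε : ℝ} (hε : 0 < ε) :
    Tendsto (fun k : ℕ => P {ω | ∃ b, ∑ i ∈ Finset.range k, (∫ ω', (S i ω' : ℝ) ∂P) *
        totalRate x b i + ε * (Real.sqrt k *
          Real.sqrt (∑ i ∈ Finset.range k, totalRate x b i ^ 2)) <
      ∑ i ∈ Finset.range k, S i ω * totalRate x b i}) atTop (𝓝 0) := by
  classical
  have hA := ha.nonneg
  refine tendsto_measure_zero_of_forall fun η hη => ?_
  -- Chosen so that Markov's inequality bounds by η/2 the probability that the squared truncation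
  -- remainders sum to more than ε²k/4.
  set ε₀ := η / 2 * (ε ^ 2 / 4) / (A + 1) with hε₀
  have hε₀pos : 0 < ε₀ := by positivity
  obtain ⟨K, hK, htail⟩ := hS.tail ε₀ hε₀pos
  have ha0 : ∀ i, 0 < a i := fun i => zero_lt_one.trans_le (ha.one_le i)
  set X : ℕ → Ω → ℝ := fun i ω => truncatedCount (K * a i) (S i ω) with hXdef
  have hKa : ∀ i, 0 ≤ K * a i := fun i => by have := ha0 i; positivity
  have hX0 : ∀ i ω, 0 ≤ X i ω := fun i ω => truncatedCount_nonneg _ _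
  have hXle : ∀ i ω, X i ω ≤ K * a i := fun i ω => truncatedCount_le (hKa i) _
  have hXL : ∀ i, MemLp (X i) 2 P := fun i => memLp_truncatedCount (hS.measurable i) (hKa i)
  have hSi : ∀ i, Integrable (fun ω => (S i ω : ℝ)) P := fun i =>
    (hS.memLp i).integrable one_le_two
  have hEX : ∀ i, 0 ≤ ∫ ω, X i ω ∂P ∧ ∫ ω, X i ω ∂P ≤ K * a i := fun i => by
    refine ⟨integral_nonneg (hX0 i), ?_⟩
    have := integral_mono ((hXL i).integrable one_le_two) (integrable_const (K * a i)) (hXle i)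
    simpa using this
  have hEXS : ∀ i, ∫ ω, X i ω ∂P ≤ ∫ ω, (S i ω : ℝ) ∂P := fun i =>
    integral_mono ((hXL i).integrable one_le_two) (hSi i) fun ω => truncatedCount_le_self _ _
  have hbdd : ∀ i ω, |X i ω - ∫ ω', X i ω' ∂P| ≤ K * a i := fun i ω => by
    rw [abs_le]
    constructor <;> linarith [hX0 i ω, hXle i ω, (hEX i).1, (hEX i).2]
  have hvar : ∀ i, Var[X i; P] ≤ K ^ 2 * a i ^ 2 := fun i => by
    rw [← mul_pow]
    refine variance_le_sq_of_abs_le (hXL i).aestronglyMeasurable.aemeasurable fun ω => ?_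
    rw [abs_of_nonneg (hX0 i ω)]
    exact hXle i ω
  have hind : Pairwise fun i j => IndepFun (X i) (X j) P := fun i j hij =>
    (hS.indep hij).comp (measurable_truncatedCount _) (measurable_truncatedCount _)
  obtain ⟨δ, hδ, hdet⟩ := exists_abs_sum_exp_le (ι := (i : ℕ) × Fin (T i)) (p := p) hK.le
    (by positivity : 0 ≤ m * A) (half_pos hε)
  have hVC := tendsto_measure_exists_positivitySet (P := P) hT
    (levelCoords (fun j : (i : ℕ) × Fin (T i) => x j.1 j.2) fun j => a j.1) ha hXL hind hK.le
    hvar hbdd hδ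
  have hVC' := (ENNReal.tendsto_nhds_zero.1 hVC) (ENNReal.ofReal (η / 2))
    (ENNReal.ofReal_pos.2 (half_pos hη))
  filter_upwards [hVC', eventually_gt_atTop 0] with k hk1 hk
  have hk' : (0 : ℝ) < k := by exact_mod_cast hk
  have hbad := measure_lt_sum_ofReal_le (P := P) (k := k) (r := ε ^ 2 / 4 * k) (B := ε₀ * (A * k))
    (f := fun i ω => ((S i ω : ℝ) - X i ω) ^ 2) (fun i => ((hS.memLp i).sub (hXL i)).integrable_sq)
    (fun i ω => sq_nonneg _) (by positivity) (by
      calc _ ≤ ∑ i ∈ Finset.range k, ε₀ * a i ^ 2 := by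
            refine Finset.sum_le_sum fun i _ => ?_
            simp only [hXdef]
            rw [integral_sub_truncatedCount_sq (hS.measurable i)]
            exact htail i
        _ ≤ _ := by
            rw [← Finset.mul_sum]
            exact mul_le_mul_of_nonneg_left (ha.sum_sq_le k) hε₀pos.le)
  have hη2 : ε₀ * (A * k) / (ε ^ 2 / 4 * k) ≤ η / 2 := by
    rw [div_le_iff₀ (by positivity)]
    calc ε₀ * (A * k) ≤ ε₀ * (A + 1) * k := by nlinarith [mul_pos hε₀pos hk']
      _ = _ := by rw [hε₀]; field_simp
  have hsum : ENNReal.ofReal η = ENNReal.ofReal (η / 2) + ENNReal.ofReal (η / 2) := by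
    rw [← ENNReal.ofReal_add (by positivity) (by positivity), add_halves]
  rw [hsum]
  refine le_trans (measure_mono ?_) ((measure_union_le _ _).trans
    (add_le_add (hbad.trans (ENNReal.ofReal_le_ofReal hη2)) hk1))
  rintro ω ⟨b, hb⟩
  by_contra hcon
  simp only [Set.mem_union, Set.mem_ofPred_eq, not_or, not_lt, not_exists] at hcon
  obtain ⟨hc1, hc2⟩ := hcon
  set R := Real.sqrt (∑ i ∈ Finset.range k, totalRate x b i ^ 2) with hR
  have hR2 : R ^ 2 = ∑ i ∈ Finset.range k, totalRate x b i ^ 2 :=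
    Real.sq_sqrt (Finset.sum_nonneg fun i _ => sq_nonneg _)
  have hR0 : 0 ≤ R := Real.sqrt_nonneg _
  -- Cauchy–Schwarz separates the remainder from b, which makes this bound uniform.
  have hpart1 : ∑ i ∈ Finset.range k, ((S i ω : ℝ) - X i ω) * totalRate x b i
      ≤ ε / 2 * (Real.sqrt k * R) := by
    have hCS := Finset.sum_mul_sq_le_sq_mul_sq (Finset.range k)
      (fun i => (S i ω : ℝ) - X i ω) (totalRate x b)
    refine le_of_sq_le_sq (hCS.trans ?_) (by positivity)
    calc _ ≤ ε ^ 2 / 4 * k * ∑ i ∈ Finset.range k, totalRate x b i ^ 2 := by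
          gcongr
      _ = _ := by
          rw [← hR2, mul_pow, mul_pow, Real.sq_sqrt hk'.le]; ring
  have hpart2 : ∑ i ∈ Finset.range k, (X i ω - ∫ ω', X i ω' ∂P) * totalRate x b i
      ≤ ε / 2 * (Real.sqrt k * R) := by
    rcases hR0.eq_or_lt with h0 | hRpos
    -- R = 0 is possible when no observation has been made; every term then vanishes.
    · have hz : ∀ i ∈ Finset.range k, totalRate x b i = 0 := by
        rw [← h0] at hR2
        intro i hi
        have := (Finset.sum_eq_zero_iff_of_nonneg fun i _ => sq_nonneg (totalRate x b i)).1
          (by rw [← hR2]; simp) i hi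
        exact pow_eq_zero_iff two_ne_zero |>.1 this
      rw [← h0, Finset.sum_eq_zero fun i hi => by rw [hz i hi, mul_zero]]
      simp
    · have := hdet (observations T k) (fun j => x j.1 j.2) (fun j => a j.1)
        (fun j => X j.1 ω - ∫ ω', X j.1 ω' ∂P) b k R hk' hRpos (fun j _ => ha0 j.1)
        (fun j _ => hbdd j.1 ω) ?_ ?_ hc2
      · rw [sum_observations] at this
        refine le_of_eq_of_le ?_ ((le_abs_self _).trans this)
        refine Finset.sum_congr rfl fun i _ => ?_
        rw [totalRate, Finset.mul_sum]
        rfl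
      · rw [sum_observations]
        calc _ ≤ ∑ i ∈ Finset.range k, m * a i ^ 2 := by
              refine Finset.sum_le_sum fun i _ => ?_
              simp only [Finset.sum_const, Finset.card_univ, Fintype.card_fin, nsmul_eq_mul]
              have : (T i : ℝ) ≤ m := by exact_mod_cast hT i
              gcongr
          _ ≤ m * (A * k) := by
              rw [← Finset.mul_sum]
              exact mul_le_mul_of_nonneg_left (ha.sum_sq_le k) (by positivity)
          _ = _ := by ring
      · rw [sum_observations, hR2]
        refine Finset.sum_le_sum fun i _ => ?_
        exact Finset.sum_sq_le_sq_sum_of_nonneg fun t _ => (Real.exp_pos (x i t ⬝ᵥ b)).le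
  -- Only an upper bound is needed and the rates are nonnegative, so truncation of the means costs
  -- nothing.
  have hpart3 : ∑ i ∈ Finset.range k, (∫ ω', X i ω' ∂P) * totalRate x b i
      ≤ ∑ i ∈ Finset.range k, (∫ ω', (S i ω' : ℝ) ∂P) * totalRate x b i :=
    Finset.sum_le_sum fun i _ => mul_le_mul_of_nonneg_right (hEXS i) (totalRate_nonneg x b i)
  have hdec : ∑ i ∈ Finset.range k, S i ω * totalRate x b i
      = ∑ i ∈ Finset.range k, ((S i ω : ℝ) - X i ω) * totalRate x b i
        + ∑ i ∈ Finset.range k, (X i ω - ∫ ω', X i ω' ∂P) * totalRate x b i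
        + ∑ i ∈ Finset.range k, (∫ ω', X i ω' ∂P) * totalRate x b i := by
    rw [← Finset.sum_add_distrib, ← Finset.sum_add_distrib]
    exact Finset.sum_congr rfl fun i _ => by ring
  linarith

/-- The sums of `S i * (S i - 1)` do not fall short of their expectations by more than `o(k)`. -/
lemma tendsto_measure_sum_mul_pred_lt {a : ℕ → ℝ} {A : ℝ} (ha : ModerateScale a A)
    {S : ℕ → Ω → ℕ} (hS : UniformlyIntegrableCounts P S a) {ε : ℝ} (hε : 0 < ε) :
    Tendsto (fun k : ℕ => P {ω | ∑ i ∈ Finset.range k, ((S i ω : ℝ) ^ 2 - S i ω) <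
      ∑ i ∈ Finset.range k, (∫ ω', ((S i ω' : ℝ) ^ 2 - S i ω') ∂P) - ε * k}) atTop (𝓝 0) := by
  have hA := ha.nonneg
  set ε₀ := ε / 2 / (A + 1) with hε₀
  have hε₀pos : 0 < ε₀ := by positivity
  obtain ⟨K, hK, htail⟩ := hS.tail ε₀ hε₀pos
  have hKa : ∀ i, 0 ≤ K * a i := fun i => by
    have := zero_lt_one.trans_le (ha.one_le i); positivity
  set X : ℕ → Ω → ℝ := fun i ω => truncatedCount (K * a i) (S i ω) with hXdef
  set Y : ℕ → Ω → ℝ := fun i ω => X i ω ^ 2 - X i ω with hYdef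
  have hXL : ∀ i, MemLp (X i) 2 P := fun i => memLp_truncatedCount (hS.measurable i) (hKa i)
  have hmeas : ∀ i, Measurable fun n => truncatedCount (K * a i) n ^ 2 - truncatedCount (K * a i) n :=
    fun i => measurable_of_countable _
  have hYabs : ∀ i ω, |Y i ω| ≤ (K * a i) ^ 2 := fun i ω => by
    rw [abs_of_nonneg (truncatedCount_mul_pred_bounds _ _).2.2]
    have h1 : X i ω ≤ K * a i := truncatedCount_le (hKa i) _
    have h2 : 0 ≤ X i ω := truncatedCount_nonneg _ _
    nlinarith
  have hYmeas : ∀ i, Measurable (Y i) := fun i => (hmeas i).comp (hS.measurable i)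
  have hYL : ∀ i, MemLp (Y i) 2 P := fun i =>
    MemLp.of_bound (hYmeas i).aestronglyMeasurable _ (ae_of_all _ (hYabs i))
  have hind : Pairwise fun i j => IndepFun (Y i) (Y j) P := fun i j hij =>
    (hS.indep hij).comp (hmeas i) (hmeas j)
  have hvar : ∀ i, Var[Y i; P] ≤ K ^ 4 * a i ^ 4 := fun i =>
    (variance_le_sq_of_abs_le (hYmeas i).aemeasurable (hYabs i)).trans (le_of_eq (by ring))
  have hY := tendsto_measure_abs_centered_sum_ge ha hYL hind hvar (half_pos hε)
  refine tendsto_measure_zero_mono hY (Eventually.of_forall fun k ω hω => ?_)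
  simp only [Set.mem_ofPred_eq] at hω ⊢
  have h1 : ∑ i ∈ Finset.range k, Y i ω ≤ ∑ i ∈ Finset.range k, ((S i ω : ℝ) ^ 2 - S i ω) :=
    Finset.sum_le_sum fun i _ => (truncatedCount_mul_pred_bounds _ _).1
  have h2 : ∑ i ∈ Finset.range k, (∫ ω', ((S i ω' : ℝ) ^ 2 - S i ω') ∂P)
      ≤ ∑ i ∈ Finset.range k, (∫ ω', Y i ω' ∂P) + ε / 2 * k := by
    calc _ ≤ ∑ i ∈ Finset.range k, ((∫ ω', Y i ω' ∂P) + ε₀ * a i ^ 2) := by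
          refine Finset.sum_le_sum fun i _ => ?_
          have h3 : Integrable (fun ω => ((S i ω : ℝ) - X i ω) ^ 2) P :=
            ((hS.memLp i).sub (hXL i)).integrable_sq
          have h4 := integral_mono (μ := P)
            ((hS.memLp i).integrable_sq.sub ((hS.memLp i).integrable one_le_two))
            (((hYL i).integrable one_le_two).add h3)
            (fun ω => (truncatedCount_mul_pred_bounds (K * a i) (S i ω)).2.1)
          have h5 := integral_add ((hYL i).integrable one_le_two) h3
          have h6 := htail i
          rw [← integral_sub_truncatedCount_sq (hS.measurable i)] at h6
          simp only [Pi.add_apply, Pi.sub_apply] at h4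
          linarith
      _ ≤ _ := by
          rw [Finset.sum_add_distrib, ← Finset.mul_sum]
          have h7 : ε₀ * ∑ i ∈ Finset.range k, a i ^ 2 ≤ ε₀ * (A * k) :=
            mul_le_mul_of_nonneg_left (ha.sum_sq_le k) hε₀pos.le
          have h8 : ε₀ * (A * k) ≤ ε / 2 * k := by
            have h9 : ε / 2 = ε₀ * (A + 1) := by rw [hε₀]; field_simp
            rw [h9, ← mul_assoc]
            have : (0 : ℝ) ≤ k := Nat.cast_nonneg k
            gcongr; linarith
          linarith
  rw [Finset.sum_sub_distrib]
  refine le_trans ?_ (neg_le_abs _)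
  linarith

end Truncation

/-! ### Poisson moments up to order three -/

section PoissonMoments

lemma lintegral_poissonMeasure (r : ℝ≥0) (f : ℕ → ℝ≥0∞) :
    ∫⁻ n, f n ∂(poissonMeasure r)
      = ∑' n, ENNReal.ofReal (Real.exp (-r) * r ^ n / n.factorial) * f n := by
  rw [poissonMeasure, lintegral_sum_measure]
  simp [lintegral_smul_measure]

/-- The first j terms vanish; cancelling the factorials and shifting the series by j leaves r^j
times the total Poisson mass. -/
lemma lintegral_descFactorial_poissonMeasure (r : ℝ≥0) (j : ℕ) :
    ∫⁻ n, (n.descFactorial j : ℝ≥0∞) ∂(poissonMeasure r) = (r : ℝ≥0∞) ^ j := by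
  rw [lintegral_poissonMeasure, ← (ENNReal.summable).sum_add_tsum_nat_add' (k := j)]
  rw [Finset.sum_eq_zero, zero_add]
  · have hterm : ∀ n : ℕ, ENNReal.ofReal (Real.exp (-r) * r ^ (n + j) / (n + j).factorial) *
        ((n + j).descFactorial j : ℝ≥0∞)
        = (r : ℝ≥0∞) ^ j * ENNReal.ofReal (Real.exp (-r) * r ^ n / n.factorial) := by
      intro n
      have hfac := Nat.factorial_mul_descFactorial (Nat.le_add_left j n)
      rw [Nat.add_sub_cancel] at hfac
      rw [← ENNReal.ofReal_natCast, ← ENNReal.ofReal_coe_nnreal, ← ENNReal.ofReal_pow (by simp),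
        ← ENNReal.ofReal_mul (by positivity), ← ENNReal.ofReal_mul (by positivity)]
      congr 1
      rw [← hfac]
      have h1 : (n.factorial : ℝ) ≠ 0 := by positivity
      have h2 : ((n + j).descFactorial j : ℝ) ≠ 0 := by
        exact_mod_cast (Nat.pow_sub_le_descFactorial (n + j) j).trans_lt' (by
          apply pow_pos; omega) |>.ne'
      push_cast
      field_simp
      ring
    simp only [hterm]
    rw [ENNReal.tsum_mul_left, ← ENNReal.ofReal_tsum_of_nonneg (fun n => by positivity)
      (hasSum_one_poissonMeasure r).summable, (hasSum_one_poissonMeasure r).tsum_eq]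
    simp
  · intro n hn
    rw [Nat.descFactorial_of_lt (Finset.mem_range.1 hn)]
    simp

lemma lintegral_id_poissonMeasure (r : ℝ≥0) :
    ∫⁻ n, (n : ℝ≥0∞) ∂(poissonMeasure r) = r := by
  simpa using lintegral_descFactorial_poissonMeasure r 1

lemma lintegral_sq_poissonMeasure (r : ℝ≥0) :
    ∫⁻ n, (n : ℝ≥0∞) ^ 2 ∂(poissonMeasure r) = (r : ℝ≥0∞) ^ 2 + r := by
  have h : ∀ n : ℕ, (n : ℝ≥0∞) ^ 2 = (n.descFactorial 2 : ℝ≥0∞) + n := by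
    intro n
    rcases n with _ | n
    · simp
    · simp only [Nat.descFactorial_succ, Nat.descFactorial_zero]
      norm_cast
      simp only [Nat.add_sub_cancel, Nat.sub_zero]
      ring
  simp only [h]
  rw [lintegral_add_left (measurable_of_countable _), lintegral_descFactorial_poissonMeasure,
    lintegral_id_poissonMeasure]

lemma lintegral_cube_poissonMeasure (r : ℝ≥0) :
    ∫⁻ n, (n : ℝ≥0∞) ^ 3 ∂(poissonMeasure r) = (r : ℝ≥0∞) ^ 3 + 3 * (r : ℝ≥0∞) ^ 2 + r := by
  have h : ∀ n : ℕ, (n : ℝ≥0∞) ^ 3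
      = (n.descFactorial 3 : ℝ≥0∞) + 3 * (n.descFactorial 2 : ℝ≥0∞) + n := by
    intro n
    rcases n with _ | _ | n
    · simp
    · simp
    · simp only [Nat.descFactorial_succ, Nat.descFactorial_zero]
      norm_cast
      simp only [show n + 1 + 1 - 2 = n by omega, show n + 1 + 1 - 1 = n + 1 by omega, Nat.sub_zero]
      ring
  simp only [h]
  rw [lintegral_add_left (measurable_of_countable _), lintegral_add_left (measurable_of_countable _),
    lintegral_const_mul _ (measurable_of_countable _), lintegral_descFactorial_poissonMeasure,
    lintegral_descFactorial_poissonMeasure, lintegral_id_poissonMeasure]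

end PoissonMoments

/-! ### Moments and tails of a single count -/

namespace SaturatedRandomEffectModel

variable {Ω : Type*} [MeasurableSpace Ω] {P : Measure Ω} [IsProbabilityMeasure P]
    {p : ℕ} {T : ℕ → ℕ} {x : (i : ℕ) → Fin (T i) → Fin p → ℝ} {β : Fin p → ℝ}
    {τ : ℝ} {θ : (i : ℕ) → Fin (T i) → Ω → ℝ≥0} {N : (i : ℕ) → Fin (T i) → Ω → ℕ}

lemma lintegral_effect_count (h : SaturatedRandomEffectModel P T x β τ θ N) (i : ℕ) (t : Fin (T i))
    {F : ℝ≥0 × ℕ → ℝ≥0∞} (hF : Measurable F) :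
    ∫⁻ ω, F (θ i t ω, N i t ω) ∂P = ∫⁻ r, ∫⁻ n, F (r, n)
      ∂(poissonMeasure (r * poissonRate (x i t) β)) ∂(P.map (θ i t)) := by
  have hθ := h.measurable_effect i t
  have hN := h.measurable_count i t
  rw [← lintegral_map (f := F) hF (hθ.prodMk hN),
    ← compProd_map_condDistrib (X := θ i t) hN.aemeasurable, Measure.lintegral_compProd hF]
  refine lintegral_congr_ae ?_
  filter_upwards [h.poisson i t] with r hr
  rw [hr]

lemma lintegral_effect (h : SaturatedRandomEffectModel P T x β τ θ N) (i : ℕ) (t : Fin (T i)) :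
    ∫⁻ r, (r : ℝ≥0∞) ∂(P.map (θ i t)) = 1 := by
  rw [lintegral_map measurable_coe_nnreal_ennreal (h.measurable_effect i t)]
  have h1 := ofReal_integral_eq_lintegral_ofReal ((h.memLp i t).integrable one_le_two)
    (ae_of_all _ fun ω => NNReal.coe_nonneg _)
  rw [h.mean i t] at h1
  simpa using h1.symm

lemma lintegral_effect_sq (h : SaturatedRandomEffectModel P T x β τ θ N) (i : ℕ) (t : Fin (T i)) :
    ∫⁻ r, (r : ℝ≥0∞) ^ 2 ∂(P.map (θ i t)) = ENNReal.ofReal (1 + τ ^ 2) := by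
  rw [lintegral_map (measurable_coe_nnreal_ennreal.pow_const 2) (h.measurable_effect i t)]
  have h1 := ofReal_integral_eq_lintegral_ofReal (h.memLp i t).integrable_sq
    (ae_of_all _ fun ω => sq_nonneg _)
  have h2 := variance_eq_sub (h.memLp i t)
  rw [h.variance i t, h.mean i t] at h2
  simp only [Pi.pow_apply] at h2
  rw [show ∫ ω, (θ i t ω : ℝ) ^ 2 ∂P = 1 + τ ^ 2 by linarith] at h1
  rw [h1]
  refine lintegral_congr fun ω => ?_
  rw [ENNReal.ofReal_pow (NNReal.coe_nonneg _), ENNReal.ofReal_coe_nnreal]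

lemma lintegral_count (h : SaturatedRandomEffectModel P T x β τ θ N) (i : ℕ) (t : Fin (T i)) :
    ∫⁻ ω, (N i t ω : ℝ≥0∞) ∂P = poissonRate (x i t) β := by
  rw [h.lintegral_effect_count i t (F := fun q => (q.2 : ℝ≥0∞)) (by fun_prop)]
  simp only [lintegral_id_poissonMeasure, ENNReal.coe_mul]
  rw [lintegral_mul_const _ measurable_coe_nnreal_ennreal, h.lintegral_effect, one_mul]

lemma lintegral_count_sq (h : SaturatedRandomEffectModel P T x β τ θ N) (i : ℕ) (t : Fin (T i)) :
    ∫⁻ ω, (N i t ω : ℝ≥0∞) ^ 2 ∂P = ENNReal.ofReal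
      ((1 + τ ^ 2) * (poissonRate (x i t) β : ℝ) ^ 2 + poissonRate (x i t) β) := by
  rw [h.lintegral_effect_count i t (F := fun q => (q.2 : ℝ≥0∞) ^ 2) (by fun_prop)]
  simp only [lintegral_sq_poissonMeasure, ENNReal.coe_mul, mul_pow]
  rw [lintegral_add_left ((measurable_coe_nnreal_ennreal.pow_const 2).mul_const _),
    lintegral_mul_const _ measurable_coe_nnreal_ennreal,
    lintegral_mul_const _ (measurable_coe_nnreal_ennreal.pow_const 2), h.lintegral_effect, one_mul,
    h.lintegral_effect_sq, ENNReal.ofReal_add (q := (poissonRate (x i t) β : ℝ)) (by positivity)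
      (by positivity), ENNReal.ofReal_mul (by positivity), ENNReal.ofReal_pow (by positivity),
    ENNReal.ofReal_coe_nnreal]

lemma measurable_count_real (h : SaturatedRandomEffectModel P T x β τ θ N) (i : ℕ)
    (t : Fin (T i)) : Measurable fun ω => (N i t ω : ℝ) :=
  measurable_from_top.comp (h.measurable_count i t)

lemma memLp_count (h : SaturatedRandomEffectModel P T x β τ θ N) (i : ℕ) (t : Fin (T i)) :
    MemLp (fun ω => (N i t ω : ℝ)) 2 P := by
  have hm := (h.measurable_count_real i t).aestronglyMeasurable (μ := P)
  rw [memLp_two_iff_integrable_sq hm]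
  refine ⟨hm.pow 2, ?_⟩
  rw [hasFiniteIntegral_iff_ofReal (ae_of_all _ fun ω => sq_nonneg _)]
  simp only [ENNReal.ofReal_pow (Nat.cast_nonneg _), ENNReal.ofReal_natCast]
  rw [h.lintegral_count_sq]
  exact ENNReal.ofReal_lt_top

lemma integral_count (h : SaturatedRandomEffectModel P T x β τ θ N) (i : ℕ) (t : Fin (T i)) :
    ∫ ω, (N i t ω : ℝ) ∂P = poissonRate (x i t) β := by
  rw [integral_eq_lintegral_of_nonneg_ae (ae_of_all _ fun ω => Nat.cast_nonneg _)
    (h.measurable_count_real i t).aestronglyMeasurable]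
  simp only [ENNReal.ofReal_natCast]
  rw [h.lintegral_count]
  rfl

lemma variance_count (h : SaturatedRandomEffectModel P T x β τ θ N) (i : ℕ) (t : Fin (T i)) :
    Var[fun ω => (N i t ω : ℝ); P]
      = poissonRate (x i t) β + τ ^ 2 * (poissonRate (x i t) β : ℝ) ^ 2 := by
  have h1 : ∫ ω, (N i t ω : ℝ) ^ 2 ∂P
      = (1 + τ ^ 2) * (poissonRate (x i t) β : ℝ) ^ 2 + poissonRate (x i t) β := by
    rw [integral_eq_lintegral_of_nonneg_ae (ae_of_all _ fun ω => sq_nonneg _)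
      ((h.measurable_count_real i t).pow_const 2).aestronglyMeasurable]
    simp only [ENNReal.ofReal_pow (Nat.cast_nonneg _), ENNReal.ofReal_natCast]
    rw [h.lintegral_count_sq, ENNReal.toReal_ofReal (by positivity)]
  rw [variance_eq_sub (h.memLp_count i t), h.integral_count]
  simp only [Pi.pow_apply]
  rw [h1]
  ring

/-- All effects have the same law, so one level L serves them all; it comes from Markov's inequality
and absolute continuity of a finite integral. -/
lemma exists_lintegral_effect_tail_le (h : SaturatedRandomEffectModel P T x β τ θ N)
    {ε : ℝ≥0} (hε : 0 < ε) : ∃ L : ℝ≥0, 1 ≤ L ∧ ∀ i t,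
      ∫⁻ r in {r | L < r}, ((r : ℝ≥0∞) ^ 2 + r) ∂(P.map (θ i t)) ≤ ε := by
  by_cases hne : ∃ i, Nonempty (Fin (T i))
  swap
  · exact ⟨1, le_rfl, fun i t => absurd ⟨i, ⟨t⟩⟩ hne⟩
  obtain ⟨i₀, ⟨t₀⟩⟩ := hne
  have hmap : ∀ i t, P.map (θ i t) = P.map (θ i₀ t₀) := fun i t =>
    (h.identDistrib i t i₀ t₀).map_eq
  have hfin : ∫⁻ r, ((r : ℝ≥0∞) ^ 2 + r) ∂(P.map (θ i₀ t₀)) ≠ ⊤ := by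
    rw [lintegral_add_left (measurable_coe_nnreal_ennreal.pow_const 2), h.lintegral_effect_sq,
      h.lintegral_effect]
    finiteness
  obtain ⟨δ, hδ, hsmall⟩ := exists_pos_setLIntegral_lt_of_measure_lt hfin
    (ENNReal.coe_pos.2 hε).ne'
  obtain ⟨n, hn⟩ := ENNReal.exists_inv_nat_lt hδ.ne'
  have hn0 : n ≠ 0 := by
    rintro rfl
    simp at hn
  refine ⟨n, by exact_mod_cast Nat.one_le_iff_ne_zero.2 hn0, fun i t => ?_⟩
  rw [hmap i t]
  refine (hsmall _ (lt_of_le_of_lt ?_ hn)).le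
  have hmarkov := meas_ge_le_lintegral_div (μ := P.map (θ i₀ t₀))
    measurable_coe_nnreal_ennreal.aemeasurable (ε := (n : ℝ≥0∞)) (by simpa using hn0) (by simp)
  rw [h.lintegral_effect, one_div] at hmarkov
  refine le_trans (measure_mono fun r hr => ?_) hmarkov
  simp only [Set.mem_ofPred_eq] at hr ⊢
  exact_mod_cast hr.le

/-- Uniform integrability of the normalised squared counts. -/
lemma exists_lintegral_count_tail_le (h : SaturatedRandomEffectModel P T x β τ θ N)
    {ε : ℝ≥0} (hε : 0 < ε) : ∃ K : ℝ≥0, 0 < K ∧ ∀ i t, ∀ a : ℝ≥0, 1 ≤ a →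
      poissonRate (x i t) β ≤ a →
      ∫⁻ ω, (if K * a < (N i t ω : ℝ≥0) then (N i t ω : ℝ≥0∞) ^ 2 else 0) ∂P
        ≤ ε * (a : ℝ≥0∞) ^ 2 := by
  obtain ⟨L, hL, htail⟩ := h.exists_lintegral_effect_tail_le (half_pos hε)
  -- Makes 5(La)³/(Ka) equal to (ε/2)a², where 5(La)³ bounds the third Poisson moment at an effect r
  -- ≤ L.
  set K : ℝ≥0 := 5 * L ^ 3 * (2 / ε) with hK
  have hL0 : 0 < L := zero_lt_one.trans_le hL
  have hK0 : 0 < K := by positivity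
  refine ⟨K, hK0, fun i t a ha hlam => ?_⟩
  set lam := poissonRate (x i t) β with hlamdef
  have ha0 : 0 < a := zero_lt_one.trans_le ha
  have hKa : K * a ≠ 0 := by positivity
  rw [h.lintegral_effect_count i t
    (F := fun q => if K * a < (q.2 : ℝ≥0) then (q.2 : ℝ≥0∞) ^ 2 else 0)
    (Measurable.comp (g := fun n : ℕ => if K * a < (n : ℝ≥0) then (n : ℝ≥0∞) ^ 2 else 0)
      (measurable_of_countable _) measurable_snd)]
  have hinner : ∀ r : ℝ≥0, ∫⁻ n : ℕ, (if K * a < (n : ℝ≥0) then (n : ℝ≥0∞) ^ 2 else 0)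
      ∂(poissonMeasure (r * lam)) ≤
      (a : ℝ≥0∞) ^ 2 * Set.indicator {r | L < r} (fun r => (r : ℝ≥0∞) ^ 2 + r) r
        + (ε / 2 : ℝ≥0) * (a : ℝ≥0∞) ^ 2 := by
    intro r
    -- Large effects are absorbed by the tail of the mixing law; for the others n² ≤ n³/(Ka) on the
    -- tail event.
    by_cases hr : L < r
    · refine le_add_right ?_
      rw [Set.indicator_of_mem (by simpa using hr)]
      calc _ ≤ ∫⁻ n : ℕ, (n : ℝ≥0∞) ^ 2 ∂(poissonMeasure (r * lam)) := by
            refine lintegral_mono fun n => ?_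
            split_ifs <;> simp
        _ = (((r * lam) ^ 2 + r * lam : ℝ≥0) : ℝ≥0∞) := by
            rw [lintegral_sq_poissonMeasure]; push_cast; ring
        _ ≤ ((a ^ 2 * (r ^ 2 + r) : ℝ≥0) : ℝ≥0∞) := by
            refine ENNReal.coe_le_coe.2 ?_
            calc (r * lam) ^ 2 + r * lam ≤ (r * a) ^ 2 + r * a ^ 2 := by
                  gcongr
                  exact hlam.trans (le_self_pow₀ ha two_ne_zero)
              _ = _ := by ring
        _ = _ := by push_cast; ring
    · refine le_add_left ?_
      have hrL := not_lt.1 hr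
      calc _ ≤ ∫⁻ n : ℕ, ((K * a)⁻¹ : ℝ≥0) * (n : ℝ≥0∞) ^ 3 ∂(poissonMeasure (r * lam)) := by
            refine lintegral_mono fun n => ?_
            split_ifs with hn
            · have : (n : ℝ≥0) ^ 2 ≤ (K * a)⁻¹ * (n : ℝ≥0) ^ 3 := by
                rw [← div_eq_inv_mul, le_div_iff₀ (by positivity)]
                calc (n : ℝ≥0) ^ 2 * (K * a) ≤ (n : ℝ≥0) ^ 2 * n := by gcongr
                  _ = _ := by ring
              have h2 := ENNReal.coe_le_coe.2 this
              push_cast at h2 ⊢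
              exact h2
            · simp
        _ = (((K * a)⁻¹ * ((r * lam) ^ 3 + 3 * (r * lam) ^ 2 + r * lam) : ℝ≥0) : ℝ≥0∞) := by
            rw [lintegral_const_mul _ (measurable_of_countable _), lintegral_cube_poissonMeasure]
            push_cast; ring
        _ ≤ ((ε / 2 * a ^ 2 : ℝ≥0) : ℝ≥0∞) := by
            refine ENNReal.coe_le_coe.2 ?_
            rw [← div_eq_inv_mul, div_le_iff₀ (by positivity)]
            have h1 : r * lam ≤ L * a := by gcongr
            have h2 : 1 ≤ L * a := one_le_mul hL ha
            calc (r * lam) ^ 3 + 3 * (r * lam) ^ 2 + r * lam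
                ≤ (L * a) ^ 3 + 3 * (L * a) ^ 2 + L * a := by gcongr
              _ ≤ (L * a) ^ 3 + 3 * (L * a) ^ 3 + (L * a) ^ 3 := by
                  gcongr ?_ + 3 * ?_ + ?_
                  · exact le_rfl
                  · exact pow_le_pow_right₀ h2 (by norm_num)
                  · exact le_self_pow₀ h2 (by norm_num)
              _ = _ := by
                  rw [hK]
                  field_simp
                  ring
        _ = _ := by
            push_cast; rfl
  refine (lintegral_mono hinner).trans ?_
  have hms : MeasurableSet {r : ℝ≥0 | L < r} := measurableSet_Ioi
  have hmf : Measurable fun r : ℝ≥0 => (r : ℝ≥0∞) ^ 2 + r := by fun_prop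
  rw [lintegral_add_right _ measurable_const, lintegral_const,
    lintegral_const_mul _ (hmf.indicator hms), lintegral_indicator hms]
  have : IsProbabilityMeasure (P.map (θ i t)) :=
    Measure.isProbabilityMeasure_map (h.measurable_effect i t).aemeasurable
  rw [measure_univ, mul_one]
  calc _ ≤ (a : ℝ≥0∞) ^ 2 * (ε / 2 : ℝ≥0) + (ε / 2 : ℝ≥0) * (a : ℝ≥0∞) ^ 2 := by
        gcongr; exact htail i t
    _ = ((ε / 2 : ℝ≥0) + (ε / 2 : ℝ≥0)) * (a : ℝ≥0∞) ^ 2 := by ring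
    _ = _ := by rw [← ENNReal.coe_add, add_halves]

end SaturatedRandomEffectModel

/-! ### Negligibility of individual rates -/

section Scale

/-- Convergence of the averages, not just boundedness, forces Λ_k²/k → 0 by differencing. With a_i =
1 + Λ_i, the sum of a_i⁴ is then, up to the term i = 0, at most k Σ (a_i²/i) a_i² = k·o(k). -/
lemma ModerateScale.of_tendsto_average {Λ : ℕ → ℝ} (hΛ : ∀ i, 0 ≤ Λ i) {c₀ : ℝ}
    (hlim : Tendsto (fun k : ℕ => (∑ i ∈ Finset.range k, Λ i ^ 2) / (k : ℝ)) atTop (𝓝 c₀)) :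
    ∃ A, ModerateScale (fun i => 1 + Λ i) A := by
  obtain ⟨B, hB⟩ := hlim.bddAbove_range
  have hsum : ∀ k : ℕ, ∑ i ∈ Finset.range k, Λ i ^ 2 ≤ B * k := by
    intro k
    rcases Nat.eq_zero_or_pos k with rfl | hk
    · simp
    · have := hB ⟨k, rfl⟩
      dsimp only at this
      rwa [div_le_iff₀ (by exact_mod_cast hk)] at this
  have hsq : ∀ k : ℕ, ∑ i ∈ Finset.range k, (1 + Λ i) ^ 2 ≤ (2 + 2 * B) * k := by
    intro k
    calc _ ≤ ∑ i ∈ Finset.range k, (2 + 2 * Λ i ^ 2) :=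
          Finset.sum_le_sum fun i _ => by nlinarith [sq_nonneg (1 - Λ i)]
      _ ≤ _ := by
          rw [Finset.sum_add_distrib, ← Finset.mul_sum]
          simp only [Finset.sum_const, Finset.card_range, nsmul_eq_mul]
          linarith [hsum k]
  have hk1 : Tendsto (fun k : ℕ => ((k : ℝ))⁻¹) atTop (𝓝 0) := tendsto_inv_atTop_nhds_zero_nat
  have hterm : Tendsto (fun k : ℕ => Λ k ^ 2 / (k : ℝ)) atTop (𝓝 0) := by
    have h1 := ((hlim.comp (tendsto_add_atTop_nat 1)).mul (hk1.const_add 1)).sub hlim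
    simp only [add_zero, mul_one, sub_self] at h1
    refine h1.congr' ?_
    filter_upwards [eventually_gt_atTop 0] with k hk
    have hk' : (k : ℝ) ≠ 0 := by positivity
    have hk'' : (k : ℝ) + 1 ≠ 0 := by positivity
    simp only [Function.comp_apply, Finset.sum_range_succ]
    push_cast
    field_simp
    ring
  have hc : Tendsto (fun k : ℕ => (1 + Λ k) ^ 2 / (k : ℝ)) atTop (𝓝 0) := by
    have h2 : Tendsto (fun k : ℕ => 2 * (k : ℝ)⁻¹ + 2 * (Λ k ^ 2 / (k : ℝ))) atTop (𝓝 0) := by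
      simpa using (hk1.const_mul 2).add (hterm.const_mul 2)
    refine squeeze_zero (fun k => by positivity) (fun k => ?_) h2
    rw [← div_eq_mul_inv, ← mul_div_assoc, ← add_div]
    gcongr
    nlinarith [sq_nonneg (1 - Λ k)]
  refine ⟨2 + 2 * B, fun i => by linarith [hΛ i], hsq, ?_⟩
  have hlo : (fun i : ℕ => (1 + Λ i) ^ 2 / (i : ℝ) * (1 + Λ i) ^ 2)
      =o[atTop] fun i : ℕ => (1 + Λ i) ^ 2 := by
    have := (Asymptotics.isLittleO_one_iff ℝ).2 hc
    simpa using this.mul_isBigO (Asymptotics.isBigO_refl (fun i : ℕ => (1 + Λ i) ^ 2) atTop)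
  have hdiv : Tendsto (fun n => ∑ i ∈ Finset.range n, (1 + Λ i) ^ 2) atTop atTop := by
    refine tendsto_atTop_mono (fun n => ?_) tendsto_natCast_atTop_atTop
    calc (n : ℝ) = ∑ i ∈ Finset.range n, 1 := by simp
      _ ≤ _ := Finset.sum_le_sum fun i _ => by nlinarith [hΛ i]
  have hlo2 := hlo.sum_range (fun i => sq_nonneg _) hdiv
  have hO : (fun n : ℕ => ∑ i ∈ Finset.range n, (1 + Λ i) ^ 2) =O[atTop] fun n : ℕ => (n : ℝ) := by
    refine Asymptotics.IsBigO.of_bound (2 + 2 * B) (Eventually.of_forall fun n => ?_)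
    rw [Real.norm_of_nonneg (Finset.sum_nonneg fun i _ => sq_nonneg _),
      Real.norm_of_nonneg (Nat.cast_nonneg n)]
    exact hsq n
  have h3 := (hlo2.trans_isBigO hO).tendsto_div_nhds_zero
  have h4 : Tendsto (fun k : ℕ => (1 + Λ 0) ^ 4 * ((k : ℝ)⁻¹ * (k : ℝ)⁻¹)) atTop (𝓝 0) := by
    simpa using (hk1.mul hk1).const_mul ((1 + Λ 0) ^ 4)
  have h5 := h4.add h3
  rw [add_zero] at h5
  refine squeeze_zero' (Eventually.of_forall fun k => by positivity) ?_ h5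
  filter_upwards [eventually_gt_atTop 0] with k hk
  have hk' : (0 : ℝ) < k := by exact_mod_cast hk
  -- The term i = 0 is split off, since division by zero makes its weight 0 on the right.
  have hmain : ∑ i ∈ Finset.range k, (1 + Λ i) ^ 4 ≤ (1 + Λ 0) ^ 4 +
      k * ∑ i ∈ Finset.range k, (1 + Λ i) ^ 2 / (i : ℝ) * (1 + Λ i) ^ 2 := by
    obtain ⟨k, rfl⟩ := Nat.exists_eq_succ_of_ne_zero hk.ne'
    rw [Finset.sum_range_succ', Finset.sum_range_succ', add_comm]
    simp only [Nat.cast_zero, div_zero, zero_mul, add_zero]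
    rw [Finset.mul_sum]
    refine add_le_add le_rfl (Finset.sum_le_sum fun i hi => ?_)
    have hi1 : ((i + 1 : ℕ) : ℝ) ≤ (k.succ : ℕ) := by
      exact_mod_cast Nat.succ_le_succ (Finset.mem_range.1 hi).le
    have hi0 : (0 : ℝ) < ((i + 1 : ℕ) : ℝ) := by positivity
    calc (1 + Λ (i + 1)) ^ 4 = ((i + 1 : ℕ) : ℝ) *
          ((1 + Λ (i + 1)) ^ 2 / ((i + 1 : ℕ) : ℝ) * (1 + Λ (i + 1)) ^ 2) := by field_simp
      _ ≤ _ := by gcongr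
  calc _ ≤ ((1 + Λ 0) ^ 4 +
      k * ∑ i ∈ Finset.range k, (1 + Λ i) ^ 2 / (i : ℝ) * (1 + Λ i) ^ 2) / (k : ℝ) ^ 2 := by gcongr
    _ = _ := by field_simp

end Scale

/-! ### Totals per individual: independence, moments, uniform integrability -/

/-- The total number of claims of individual `i`. -/
def totalCount {Ω : Type*} {T : ℕ → ℕ} (N : (i : ℕ) → Fin (T i) → Ω → ℕ) (i : ℕ) (ω : Ω) : ℕ :=
  ∑ t, N i t ω

lemma totalCount_eq {Ω : Type*} {T : ℕ → ℕ} {N : (i : ℕ) → Fin (T i) → Ω → ℕ} (i : ℕ) :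
    (fun ω => (totalCount N i ω : ℝ)) = fun ω => ∑ t, (1 : ℝ) * (N i t ω : ℝ) := by
  ext ω
  simp [totalCount]

namespace SaturatedRandomEffectModel

variable {Ω : Type*} [MeasurableSpace Ω] {P : Measure Ω} [IsProbabilityMeasure P]
    {p : ℕ} {T : ℕ → ℕ} {x : (i : ℕ) → Fin (T i) → Fin p → ℝ} {β : Fin p → ℝ}
    {τ : ℝ} {θ : (i : ℕ) → Fin (T i) → Ω → ℝ≥0} {N : (i : ℕ) → Fin (T i) → Ω → ℕ}

lemma indepFun_individuals (h : SaturatedRandomEffectModel P T x β τ θ N) {E : Type*}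
    [MeasurableSpace E] (φ : (i : ℕ) → (Fin (T i) → ℕ) → E) :
    Pairwise fun i j => IndepFun (fun ω => φ i fun t => N i t ω) (fun ω => φ j fun t => N j t ω) P := by
  classical
  intro i j hij
  let s : ℕ → Finset ((i : ℕ) × Fin (T i)) := fun i => ({i} : Finset ℕ).sigma fun _ => Finset.univ
  have hmem : ∀ i t, (⟨i, t⟩ : (i : ℕ) × Fin (T i)) ∈ s i := fun i t => by simp [s]
  have hdisj : Disjoint (s i) (s j) := by
    rw [Finset.disjoint_left]
    intro q hq hq'
    simp only [s, Finset.mem_sigma, Finset.mem_singleton] at hq hq'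
    exact hij (hq.1.symm.trans hq'.1)
  have hind := h.indep.indepFun_finset (s i) (s j) hdisj fun q =>
    (h.measurable_effect q.1 q.2).prodMk (h.measurable_count q.1 q.2)
  have hψ : ∀ i, Measurable fun f : (s i → ℝ≥0 × ℕ) => φ i fun t => (f ⟨⟨i, t⟩, hmem i t⟩).2 :=
    fun i => (measurable_of_countable (φ i)).comp
      (measurable_pi_lambda _ fun t => measurable_snd.comp (measurable_pi_apply _))
  exact hind.comp (hψ i) (hψ j)

lemma indepFun_counts (h : SaturatedRandomEffectModel P T x β τ θ N) (i : ℕ) (φ : Fin (T i) → ℕ → ℝ) :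
    Pairwise fun t t' => IndepFun (fun ω => φ t (N i t ω)) (fun ω => φ t' (N i t' ω)) P := by
  intro t t' htt
  have hne : (⟨i, t⟩ : (i : ℕ) × Fin (T i)) ≠ ⟨i, t'⟩ := fun h => htt (by simpa using h)
  exact (h.indep.indepFun hne).comp ((measurable_of_countable (φ t)).comp measurable_snd)
    ((measurable_of_countable (φ t')).comp measurable_snd)

lemma memLp_linear (h : SaturatedRandomEffectModel P T x β τ θ N) (i : ℕ) (d : Fin (T i) → ℝ) :
    MemLp (fun ω => ∑ t, d t * (N i t ω : ℝ)) 2 P :=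
  memLp_finsetSum _ fun t _ => (h.memLp_count i t).const_mul (d t)

lemma integral_linear (h : SaturatedRandomEffectModel P T x β τ θ N) (i : ℕ) (d : Fin (T i) → ℝ) :
    ∫ ω, ∑ t, d t * (N i t ω : ℝ) ∂P = ∑ t, d t * (poissonRate (x i t) β : ℝ) := by
  rw [integral_finsetSum _ fun t _ =>
    ((h.memLp_count i t).integrable one_le_two).const_mul (d t)]
  simp only [integral_const_mul, h.integral_count]

lemma variance_linear (h : SaturatedRandomEffectModel P T x β τ θ N) (i : ℕ) (d : Fin (T i) → ℝ) :
    Var[fun ω => ∑ t, d t * (N i t ω : ℝ); P] = ∑ t, d t ^ 2 *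
      (poissonRate (x i t) β + τ ^ 2 * (poissonRate (x i t) β : ℝ) ^ 2) := by
  have := IndepFun.variance_sum (μ := P) (X := fun t ω => d t * (N i t ω : ℝ)) (s := Finset.univ)
    (fun t _ => (h.memLp_count i t).const_mul (d t))
    (fun t _ t' _ htt => h.indepFun_counts i (fun t n => d t * n) htt)
  rw [show (fun ω => ∑ t, d t * (N i t ω : ℝ)) = ∑ t, fun ω => d t * (N i t ω : ℝ) by
    ext ω; simp, this]
  refine Finset.sum_congr rfl fun t _ => ?_
  rw [variance_const_mul, h.variance_count]

lemma memLp_totalCount (h : SaturatedRandomEffectModel P T x β τ θ N) (i : ℕ) :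
    MemLp (fun ω => (totalCount N i ω : ℝ)) 2 P := by
  rw [totalCount_eq]
  exact h.memLp_linear i fun _ => 1

lemma integral_totalCount (h : SaturatedRandomEffectModel P T x β τ θ N) (i : ℕ) :
    ∫ ω, (totalCount N i ω : ℝ) ∂P = totalRate x β i := by
  rw [totalCount_eq, h.integral_linear]
  simp [totalRate]

lemma integral_totalCount_sq (h : SaturatedRandomEffectModel P T x β τ θ N) (i : ℕ) :
    ∫ ω, (totalCount N i ω : ℝ) ^ 2 ∂P = totalRate x β i ^ 2 + totalRate x β i +
      τ ^ 2 * ∑ t, (poissonRate (x i t) β : ℝ) ^ 2 := by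
  have h1 := variance_eq_sub (h.memLp_totalCount i)
  rw [h.integral_totalCount, totalCount_eq, h.variance_linear, ← totalCount_eq] at h1
  simp only [one_pow, one_mul, Finset.sum_add_distrib, ← Finset.mul_sum, Pi.pow_apply] at h1
  rw [totalRate] at h1 ⊢
  linarith

lemma integral_totalCount_sq_sub (h : SaturatedRandomEffectModel P T x β τ θ N) (i : ℕ) :
    ∫ ω, ((totalCount N i ω : ℝ) ^ 2 - totalCount N i ω) ∂P = totalRate x β i ^ 2 +
      τ ^ 2 * ∑ t, (poissonRate (x i t) β : ℝ) ^ 2 := by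
  rw [integral_sub (h.memLp_totalCount i).integrable_sq
    ((h.memLp_totalCount i).integrable one_le_two), h.integral_totalCount_sq,
    h.integral_totalCount]
  ring

lemma sum_rate_sq_le (x : (i : ℕ) → Fin (T i) → Fin p → ℝ) (β : Fin p → ℝ) (i : ℕ) :
    ∑ t, (poissonRate (x i t) β : ℝ) ^ 2 ≤ totalRate x β i ^ 2 :=
  Finset.sum_sq_le_sq_sum_of_nonneg fun _ _ => NNReal.coe_nonneg _

lemma totalRate_sq_le {m : ℕ} (hT : ∀ i, T i ≤ m) (x : (i : ℕ) → Fin (T i) → Fin p → ℝ)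
    (β : Fin p → ℝ) (i : ℕ) :
    totalRate x β i ^ 2 ≤ m * ∑ t, (poissonRate (x i t) β : ℝ) ^ 2 := by
  have h1 := sq_sum_le_card_mul_sum_sq (s := Finset.univ)
    (f := fun t => (poissonRate (x i t) β : ℝ))
  rw [Finset.card_univ, Fintype.card_fin] at h1
  have h2 : (T i : ℝ) ≤ m := by exact_mod_cast hT i
  refine h1.trans (mul_le_mul_of_nonneg_right h2 (Finset.sum_nonneg fun _ _ => sq_nonneg _))

/-- If the total is large, so is the largest of its at most m summands, and the total is at most m +
1 times that summand. The tail thus reduces to that of single counts; the power (m + 1)³ collects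
the squared factor and the number of summands. -/
lemma uniformlyIntegrableCounts (h : SaturatedRandomEffectModel P T x β τ θ N) {m : ℕ}
    (hT : ∀ i, T i ≤ m) :
    UniformlyIntegrableCounts P (totalCount N) (fun i => 1 + totalRate x β i) := by
  have hmeas : ∀ i, Measurable (totalCount N i) := fun i =>
    Finset.measurable_sum _ fun t _ => h.measurable_count i t
  refine ⟨hmeas, h.memLp_totalCount, h.indepFun_individuals (fun i f => ∑ t, f t),
    fun ε hε => ?_⟩
  set ε' : ℝ≥0 := ε.toNNReal / (m + 1) ^ 3 with hε'
  have hε'0 : 0 < ε' := div_pos (Real.toNNReal_pos.2 hε) (by positivity)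
  obtain ⟨K, hK, htail⟩ := h.exists_lintegral_count_tail_le hε'0
  refine ⟨(m + 1) * K, by positivity, fun i => ?_⟩
  set a : ℝ≥0 := 1 + ∑ t, poissonRate (x i t) β with ha
  have haR : (a : ℝ) = 1 + totalRate x β i := by simp [ha, totalRate]
  have hS : MeasurableSet {ω | ((m + 1) * K : ℝ) * (1 + totalRate x β i) < totalCount N i ω} :=
    (hmeas i) (MeasurableSet.of_discrete
      (s := {n : ℕ | ((m + 1) * K : ℝ) * (1 + totalRate x β i) < n}))
  have hpt : ∀ ω, Set.indicator
      {ω | ((m + 1) * K : ℝ) * (1 + totalRate x β i) < totalCount N i ω}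
      (fun ω => (totalCount N i ω : ℝ≥0∞) ^ 2) ω ≤ (m + 1) ^ 2 *
        ∑ t, (if K * a < (N i t ω : ℝ≥0) then (N i t ω : ℝ≥0∞) ^ 2 else 0) := by
    intro ω
    by_cases hω : ((m + 1) * K : ℝ) * (1 + totalRate x β i) < totalCount N i ω
    swap
    · rw [Set.indicator_of_notMem (by simpa using hω)]
      exact zero_le
    rw [Set.indicator_of_mem (by simpa using hω)]
    have hne : (Finset.univ : Finset (Fin (T i))).Nonempty := by
      by_contra hemp
      rw [Finset.not_nonempty_iff_eq_empty] at hemp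
      have h0 : totalCount N i ω = 0 := by rw [totalCount, hemp, Finset.sum_empty]
      rw [h0, ← haR] at hω
      have : (0 : ℝ) ≤ (m + 1) * K * a := by positivity
      simp only [Nat.cast_zero] at hω
      linarith
    obtain ⟨t, -, ht⟩ := Finset.exists_max_image Finset.univ (fun t => N i t ω) hne
    have hle : totalCount N i ω ≤ (m + 1) * N i t ω := by
      calc totalCount N i ω ≤ ∑ _t : Fin (T i), N i t ω := Finset.sum_le_sum ht
        _ = T i * N i t ω := by simp
        _ ≤ _ := Nat.mul_le_mul_right _ ((hT i).trans (Nat.le_succ m))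
    have hlt : K * a < (N i t ω : ℝ≥0) := by
      have h1 : (totalCount N i ω : ℝ) ≤ (m + 1) * N i t ω := by exact_mod_cast hle
      rw [← NNReal.coe_lt_coe, NNReal.coe_mul, haR, NNReal.coe_natCast]
      have h2 : ((m : ℝ) + 1) * (K * (1 + totalRate x β i)) < (m + 1) * N i t ω := by linarith
      exact lt_of_mul_lt_mul_left h2 (by positivity)
    calc (totalCount N i ω : ℝ≥0∞) ^ 2 ≤ ((m + 1) * N i t ω : ℝ≥0∞) ^ 2 := by
          gcongr; exact_mod_cast hle
      _ = (m + 1) ^ 2 * (if K * a < (N i t ω : ℝ≥0) then (N i t ω : ℝ≥0∞) ^ 2 else 0) := by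
          rw [if_pos hlt, mul_pow]
      _ ≤ _ := by
          gcongr
          exact Finset.single_le_sum
            (f := fun t => if K * a < (N i t ω : ℝ≥0) then (N i t ω : ℝ≥0∞) ^ 2 else 0)
            (fun _ _ => zero_le) (Finset.mem_univ t)
  have hmeasN : ∀ t, Measurable fun ω =>
      (if K * a < (N i t ω : ℝ≥0) then (N i t ω : ℝ≥0∞) ^ 2 else 0) := fun t =>
    (measurable_of_countable fun n : ℕ => if K * a < (n : ℝ≥0) then (n : ℝ≥0∞) ^ 2 else 0).comp
      (h.measurable_count i t)
  have hlint : ∫⁻ ω in {ω | ((m + 1) * K : ℝ) * (1 + totalRate x β i) < totalCount N i ω},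
      (totalCount N i ω : ℝ≥0∞) ^ 2 ∂P ≤ ENNReal.ofReal (ε * (1 + totalRate x β i) ^ 2) := by
    rw [← lintegral_indicator hS]
    calc _ ≤ ∫⁻ ω, (m + 1) ^ 2 *
          ∑ t, (if K * a < (N i t ω : ℝ≥0) then (N i t ω : ℝ≥0∞) ^ 2 else 0) ∂P :=
          lintegral_mono hpt
      _ = (m + 1) ^ 2 * ∑ t, ∫⁻ ω,
          (if K * a < (N i t ω : ℝ≥0) then (N i t ω : ℝ≥0∞) ^ 2 else 0) ∂P := by
          rw [lintegral_const_mul _ (Finset.measurable_sum _ fun t _ => hmeasN t),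
            lintegral_finsetSum _ fun t _ => hmeasN t]
      _ ≤ (m + 1) ^ 2 * ∑ _t : Fin (T i), (ε' : ℝ≥0∞) * (a : ℝ≥0∞) ^ 2 := by
          gcongr with t
          exact htail i t a le_self_add ((Finset.single_le_sum
            (f := fun t => poissonRate (x i t) β) (fun _ _ => zero_le)
            (Finset.mem_univ t)).trans le_add_self)
      _ = (m + 1) ^ 2 * (T i * ((ε' : ℝ≥0∞) * (a : ℝ≥0∞) ^ 2)) := by simp
      _ ≤ (m + 1) ^ 2 * ((m + 1) * ((ε' : ℝ≥0∞) * (a : ℝ≥0∞) ^ 2)) := by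
          gcongr
          exact_mod_cast (hT i).trans (Nat.le_succ m)
      _ = (((m + 1) ^ 2 * ((m + 1) * (ε' * a ^ 2)) : ℝ≥0) : ℝ≥0∞) := by push_cast; rfl
      _ = _ := by
          rw [← haR, ← ENNReal.ofReal_coe_nnreal]
          congr 1
          rw [hε']
          push_cast
          rw [Real.coe_toNNReal _ hε.le]
          field_simp
  rw [integral_eq_lintegral_of_nonneg_ae (ae_of_all _ fun ω => sq_nonneg _)
    (h.memLp_totalCount i).integrable_sq.aestronglyMeasurable.restrict]
  refine ENNReal.toReal_le_of_le_ofReal (by positivity) ?_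
  simp only [ENNReal.ofReal_pow (Nat.cast_nonneg _), ENNReal.ofReal_natCast]
  exact hlint

end SaturatedRandomEffectModel

lemma pinquetStatistic_eq {Ω : Type*} {p : ℕ} {T : ℕ → ℕ} (x : (i : ℕ) → Fin (T i) → Fin p → ℝ) (k : ℕ)
    (N : (i : ℕ) → Fin (T i) → Ω → ℕ) (b : Fin p → ℝ) (ω : Ω) :
    pinquetStatistic T x k (fun i t => N i t ω) b =
      (∑ i ∈ Finset.range k, (((totalCount N i ω : ℝ) - totalRate x b i) ^ 2 - totalCount N i ω)) /
        Real.sqrt (2 * ∑ i ∈ Finset.range k, totalRate x b i ^ 2) := by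
  simp [pinquetStatistic, totalCount, totalRate]

/-! ### Deterministic and probabilistic bounds for the statistic -/

section Statistic

variable {Ω : Type*} [MeasurableSpace Ω] {P : Measure Ω} [IsProbabilityMeasure P]

/-- Only subadditivity is used, so the events need not be measurable; this matters for events
quantified over all parameters. -/
lemma tendsto_measure_one_of_compl {B G : ℕ → Set Ω} (hB : Tendsto (fun k => P (B k)) atTop (𝓝 0))
    (h : ∀ᶠ k in atTop, ∀ ω, ω ∉ B k → ω ∈ G k) : Tendsto (fun k => P (G k)) atTop (𝓝 1) := by
  have h1 : Tendsto (fun k => 1 - P (B k)) atTop (𝓝 1) := by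
    have := ENNReal.Tendsto.sub (tendsto_const_nhds (x := (1 : ℝ≥0∞))) hB (by simp)
    simpa using this
  refine tendsto_of_tendsto_of_tendsto_of_le_of_le' h1 tendsto_const_nhds ?_
    (Eventually.of_forall fun _ => prob_le_one)
  filter_upwards [h] with k hk
  rw [tsub_le_iff_right, ← measure_univ (μ := P)]
  refine (measure_mono fun ω _ => ?_).trans (measure_union_le _ _)
  by_cases hω : ω ∈ B k
  · exact Or.inr hω
  · exact Or.inl (hk ω hω)

/-- Markov's inequality alone would give a bounded, not a vanishing, probability for fixed C.
Truncation helps: the truncated squares concentrate, and the level may depend on η while C does not.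
-/
lemma exists_tendsto_measure_sum_sq_gt {a : ℕ → ℝ} {A D : ℝ} (ha : ModerateScale a A)
    {S : ℕ → Ω → ℕ} (hS : UniformlyIntegrableCounts P S a)
    (hD : ∀ i, ∫ ω, (S i ω : ℝ) ^ 2 ∂P ≤ D * a i ^ 2) :
    ∃ C : ℝ, 0 < C ∧ Tendsto (fun k : ℕ => P {ω | C * k < ∑ i ∈ Finset.range k, (S i ω : ℝ) ^ 2})
      atTop (𝓝 0) := by
  have hA := ha.nonneg
  have hD0 : 0 ≤ D := by
    have h0 := ha.one_le 0
    have h1 : 0 ≤ D * a 0 ^ 2 := (integral_nonneg fun ω => sq_nonneg _).trans (hD 0)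
    exact nonneg_of_mul_nonneg_left h1 (by positivity)
  -- From S² ≤ 2X² + 2(S − X)², where Σ X² < (DA + 1)k and Σ (S − X)² ≤ k off the bad events.
  refine ⟨2 * (D * A + 1) + 2, by positivity, tendsto_measure_zero_of_forall fun η hη => ?_⟩
  set ε₀ := η / 2 / (A + 1) with hε₀
  have hε₀pos : 0 < ε₀ := by positivity
  obtain ⟨K, hK, htail⟩ := hS.tail ε₀ hε₀pos
  have hKa : ∀ i, 0 ≤ K * a i := fun i => by
    have := zero_lt_one.trans_le (ha.one_le i); positivity
  set X : ℕ → Ω → ℝ := fun i ω => truncatedCount (K * a i) (S i ω) with hXdef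
  have hX0 : ∀ i ω, 0 ≤ X i ω := fun i ω => truncatedCount_nonneg _ _
  have hXL : ∀ i, MemLp (X i) 2 P := fun i => memLp_truncatedCount (hS.measurable i) (hKa i)
  have hmeas : ∀ i, Measurable fun n => truncatedCount (K * a i) n ^ 2 :=
    fun i => measurable_of_countable _
  have hYabs : ∀ i ω, |X i ω ^ 2| ≤ (K * a i) ^ 2 := fun i ω => by
    rw [abs_of_nonneg (sq_nonneg _)]
    exact pow_le_pow_left₀ (hX0 i ω) (truncatedCount_le (hKa i) _) 2
  have hYmeas : ∀ i, Measurable fun ω => X i ω ^ 2 := fun i => (hmeas i).comp (hS.measurable i)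
  have hYL : ∀ i, MemLp (fun ω => X i ω ^ 2) 2 P := fun i =>
    MemLp.of_bound (hYmeas i).aestronglyMeasurable _ (ae_of_all _ (hYabs i))
  have hind : Pairwise fun i j => IndepFun (fun ω => X i ω ^ 2) (fun ω => X j ω ^ 2) P :=
    fun i j hij => (hS.indep hij).comp (hmeas i) (hmeas j)
  have hvar : ∀ i, Var[fun ω => X i ω ^ 2; P] ≤ K ^ 4 * a i ^ 4 := fun i =>
    (variance_le_sq_of_abs_le (hYmeas i).aemeasurable (hYabs i)).trans (le_of_eq (by ring))
  have hY := tendsto_measure_abs_centered_sum_ge ha hYL hind hvar one_pos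
  have hY' := (ENNReal.tendsto_nhds_zero.1 hY) (ENNReal.ofReal (η / 2))
    (ENNReal.ofReal_pos.2 (half_pos hη))
  filter_upwards [hY', eventually_gt_atTop 0] with k hk1 hk
  have hk' : (0 : ℝ) < k := by exact_mod_cast hk
  have hbad := measure_lt_sum_ofReal_le (P := P) (k := k) (r := k) (B := ε₀ * (A * k))
    (f := fun i ω => ((S i ω : ℝ) - X i ω) ^ 2) (fun i => ((hS.memLp i).sub (hXL i)).integrable_sq)
    (fun i ω => sq_nonneg _) hk' (by
      calc _ ≤ ∑ i ∈ Finset.range k, ε₀ * a i ^ 2 := by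
            refine Finset.sum_le_sum fun i _ => ?_
            simp only [hXdef]
            rw [integral_sub_truncatedCount_sq (hS.measurable i)]
            exact htail i
        _ ≤ _ := by
            rw [← Finset.mul_sum]
            exact mul_le_mul_of_nonneg_left (ha.sum_sq_le k) hε₀pos.le)
  have hη2 : ε₀ * (A * k) / k ≤ η / 2 := by
    rw [div_le_iff₀ hk']
    calc ε₀ * (A * k) ≤ ε₀ * (A + 1) * k := by nlinarith [mul_pos hε₀pos hk']
      _ = _ := by rw [hε₀]; field_simp
  have hsum : ENNReal.ofReal η = ENNReal.ofReal (η / 2) + ENNReal.ofReal (η / 2) := by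
    rw [← ENNReal.ofReal_add (by positivity) (by positivity), add_halves]
  rw [hsum]
  refine le_trans (measure_mono fun ω hω => ?_) ((measure_union_le _ _).trans
    (add_le_add (hbad.trans (ENNReal.ofReal_le_ofReal hη2)) hk1))
  by_contra hcon
  simp only [Set.mem_union, Set.mem_ofPred_eq, not_or, not_lt, not_le] at hcon hω
  obtain ⟨hc1, hc2⟩ := hcon
  have h1 : ∑ i ∈ Finset.range k, (S i ω : ℝ) ^ 2 ≤ 2 * ∑ i ∈ Finset.range k, X i ω ^ 2 +
      2 * ∑ i ∈ Finset.range k, ((S i ω : ℝ) - X i ω) ^ 2 := by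
    rw [Finset.mul_sum, Finset.mul_sum, ← Finset.sum_add_distrib]
    exact Finset.sum_le_sum fun i _ => by nlinarith [sq_nonneg ((S i ω : ℝ) - 2 * X i ω)]
  have h2 : ∑ i ∈ Finset.range k, ∫ ω', X i ω' ^ 2 ∂P ≤ D * A * k := by
    calc _ ≤ ∑ i ∈ Finset.range k, D * a i ^ 2 := by
          refine Finset.sum_le_sum fun i _ => le_trans ?_ (hD i)
          exact integral_mono (hXL i).integrable_sq (hS.memLp i).integrable_sq fun ω =>
            pow_le_pow_left₀ (hX0 i ω) (truncatedCount_le_self _ _) 2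
      _ ≤ _ := by
          rw [← Finset.mul_sum, mul_assoc]
          exact mul_le_mul_of_nonneg_left (ha.sum_sq_le k) hD0
  rw [Finset.sum_sub_distrib] at hc2
  have h3 := (le_abs_self _).trans_lt hc2
  linarith

lemma totalRate_pos_of_ne_zero {p : ℕ} {T : ℕ → ℕ} {x : (i : ℕ) → Fin (T i) → Fin p → ℝ}
    {b : Fin p → ℝ} {i : ℕ} (h : totalRate x b i ≠ 0) (b' : Fin p → ℝ) : 0 < totalRate x b' i := by
  obtain ⟨t, -, -⟩ := Finset.exists_ne_zero_of_sum_ne_zero h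
  exact Finset.sum_pos (fun t _ => Real.exp_pos (x i t ⬝ᵥ b')) ⟨t, Finset.mem_univ t⟩

lemma sum_totalRate_sq_pos {p : ℕ} {T : ℕ → ℕ} {x : (i : ℕ) → Fin (T i) → Fin p → ℝ}
    {b : Fin p → ℝ} {k : ℕ} (h : 0 < ∑ i ∈ Finset.range k, totalRate x b i ^ 2) (b' : Fin p → ℝ) :
    0 < ∑ i ∈ Finset.range k, totalRate x b' i ^ 2 := by
  obtain ⟨i, hi, hne⟩ := Finset.exists_ne_zero_of_sum_ne_zero h.ne'
  have hi' : totalRate x b i ≠ 0 := fun h0 => hne (by rw [h0]; simp)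
  exact Finset.sum_pos' (fun j _ => sq_nonneg _) ⟨i, hi, pow_pos (totalRate_pos_of_ne_zero hi' b') 2⟩

/-- Completing the square with weight 1 + ρ/2 leaves ρq²/2 ≥ μs² and ρR²/(2 + ρ) ≥ μR²; together
these dominate μsR and the fluctuation errors of size μ/4. For s = √k it absorbs the noise uniformly
in R. -/
lemma quadratic_growth {ρ q R s c₁ : ℝ} (hρ : 0 < ρ) (hq : c₁ * s ^ 2 ≤ q ^ 2) {μ : ℝ} (hμ : 0 ≤ μ) (hμ1 : μ ≤ ρ * c₁ / 2)
    (hμ2 : μ ≤ ρ / (2 + ρ)) :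
    μ * (s * R) ≤ (1 + ρ) * q ^ 2 - 2 * (q * R + μ / 4 * (s * R)) + R ^ 2 - μ / 4 * s ^ 2 := by
  have h1 : 2 * (q * R) ≤ (1 + ρ / 2) * q ^ 2 + (1 - ρ / (2 + ρ)) * R ^ 2 := by
    have h2 : 1 - ρ / (2 + ρ) = (1 + ρ / 2)⁻¹ := by field_simp; ring
    rw [h2]
    have h3 : 0 < 1 + ρ / 2 := by positivity
    have h4 : (1 + ρ / 2) * q ^ 2 + (1 + ρ / 2)⁻¹ * R ^ 2 - 2 * (q * R)
        = (1 + ρ / 2)⁻¹ * ((1 + ρ / 2) * q - R) ^ 2 := by field_simp; ring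
    have h5 : 0 ≤ (1 + ρ / 2)⁻¹ * ((1 + ρ / 2) * q - R) ^ 2 := by positivity
    linarith
  have h6 : μ * R ^ 2 ≤ ρ / (2 + ρ) * R ^ 2 := mul_le_mul_of_nonneg_right hμ2 (sq_nonneg R)
  have h7 : μ * s ^ 2 ≤ ρ / 2 * q ^ 2 := by
    calc μ * s ^ 2 ≤ ρ * c₁ / 2 * s ^ 2 := mul_le_mul_of_nonneg_right hμ1 (sq_nonneg s)
      _ = ρ / 2 * (c₁ * s ^ 2) := by ring
      _ ≤ _ := by gcongr
  nlinarith [mul_nonneg hμ (sq_nonneg (s - R)), mul_nonneg hμ (sq_nonneg s),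
    mul_nonneg hμ (sq_nonneg R)]

end Statistic

/-! ### The lower bound of order √k -/

namespace SaturatedRandomEffectModel

variable {Ω : Type*} [MeasurableSpace Ω] {P : Measure Ω} [IsProbabilityMeasure P]
    {p : ℕ} {T : ℕ → ℕ} {x : (i : ℕ) → Fin (T i) → Fin p → ℝ} {β : Fin p → ℝ}
    {τ : ℝ} {θ : (i : ℕ) → Fin (T i) → Ω → ℝ≥0} {N : (i : ℕ) → Fin (T i) → Ω → ℕ}

lemma eventually_sum_totalRate_sq_ge {c₀ : ℝ} (hc₀ : 0 < c₀)
    (hrate : Tendsto (fun k : ℕ => (∑ i ∈ Finset.range k, totalRate x β i ^ 2) / (k : ℝ))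
      atTop (𝓝 c₀)) :
    ∀ᶠ k : ℕ in atTop, 0 < k ∧ c₀ / 2 * k ≤ ∑ i ∈ Finset.range k, totalRate x β i ^ 2 := by
  filter_upwards [hrate.eventually (lt_mem_nhds (half_lt_self hc₀)), eventually_gt_atTop 0]
    with k hk hk0
  have hk' : (0 : ℝ) < k := by exact_mod_cast hk0
  rw [lt_div_iff₀ hk'] at hk
  exact ⟨hk0, hk.le⟩

/-- Whatever parameter the fitted means are computed with, the score statistic grows at least like
`√k`. -/
theorem exists_tendsto_measure_pinquetStatistic_ge (h : SaturatedRandomEffectModel P T x β τ θ N)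
    (hτ : 0 < τ) {m : ℕ} (hT : ∀ i, T i ≤ m) {c₀ : ℝ} (hc₀ : 0 < c₀)
    (hrate : Tendsto (fun k : ℕ => (∑ i ∈ Finset.range k, totalRate x β i ^ 2) / (k : ℝ))
      atTop (𝓝 c₀)) :
    ∃ c : ℝ, 0 < c ∧ Tendsto (fun k : ℕ => P {ω | ∀ b, c * Real.sqrt k ≤
      pinquetStatistic T x k (fun i t => N i t ω) b}) atTop (𝓝 1) := by
  obtain ⟨A, ha⟩ := ModerateScale.of_tendsto_average (totalRate_nonneg x β) hrate
  have hS := h.uniformlyIntegrableCounts hT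
  -- Excess of the second factorial moment, from Cauchy–Schwarz over at most m periods; m + 1 avoids
  -- a zero denominator.
  set ρ := τ ^ 2 / (m + 1) with hρ
  have hρ0 : 0 < ρ := by positivity
  set μ := min (ρ * (c₀ / 2) / 2) (ρ / (2 + ρ)) with hμ
  have hμ0 : 0 < μ := lt_min (by positivity) (by positivity)
  have hB1 := tendsto_measure_exists_correlation hT x ha hS (ε := μ / 4) (by positivity)
  have hB2 := tendsto_measure_sum_mul_pred_lt ha hS (ε := μ / 4) (by positivity)
  refine ⟨μ / Real.sqrt 2, by positivity,
    tendsto_measure_one_of_compl (tendsto_measure_zero_union hB1 hB2) ?_⟩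
  filter_upwards [eventually_sum_totalRate_sq_ge hc₀ hrate] with k hk ω hω
  obtain ⟨hk0, hQ⟩ := hk
  have hk' : (0 : ℝ) < k := by exact_mod_cast hk0
  simp only [Set.mem_union, Set.mem_ofPred_eq, not_or, not_lt, not_exists,
    h.integral_totalCount, h.integral_totalCount_sq_sub] at hω
  obtain ⟨hω1, hω2⟩ := hω
  intro b
  have hω1 := hω1 b
  rw [pinquetStatistic_eq]
  set Q := ∑ i ∈ Finset.range k, totalRate x β i ^ 2 with hQdef
  set V := ∑ i ∈ Finset.range k, totalRate x b i ^ 2 with hVdef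
  have hQ0 : 0 < Q := lt_of_lt_of_le (by positivity) hQ
  have hV0 : 0 < V := sum_totalRate_sq_pos hQ0 b
  have hsR : 0 < Real.sqrt V := Real.sqrt_pos.2 hV0
  have hcs : ∑ i ∈ Finset.range k, totalRate x β i * totalRate x b i
      ≤ Real.sqrt Q * Real.sqrt V := Real.sum_mul_le_sqrt_mul_sqrt _ _ _
  have hmean : (1 + ρ) * Q ≤ ∑ i ∈ Finset.range k, (totalRate x β i ^ 2 +
      τ ^ 2 * ∑ t, (poissonRate (x i t) β : ℝ) ^ 2) := by
    rw [hQdef, Finset.mul_sum]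
    refine Finset.sum_le_sum fun i _ => ?_
    have h1 := totalRate_sq_le (fun i => (hT i).trans (Nat.le_succ m)) x β i
    push_cast at h1
    have h2 : ρ * totalRate x β i ^ 2 ≤ τ ^ 2 * ∑ t, (poissonRate (x i t) β : ℝ) ^ 2 := by
      rw [hρ, div_mul_eq_mul_div, div_le_iff₀ (by positivity)]
      calc _ ≤ τ ^ 2 * ((m + 1) * ∑ t, (poissonRate (x i t) β : ℝ) ^ 2) := by gcongr
        _ = _ := by ring
    linarith
  have hnum : ∑ i ∈ Finset.range k,
      (((totalCount N i ω : ℝ) - totalRate x b i) ^ 2 - totalCount N i ω)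
      = ∑ i ∈ Finset.range k, ((totalCount N i ω : ℝ) ^ 2 - totalCount N i ω)
        - 2 * ∑ i ∈ Finset.range k, totalCount N i ω * totalRate x b i + V := by
    rw [hVdef, Finset.mul_sum, ← Finset.sum_sub_distrib, ← Finset.sum_add_distrib]
    exact Finset.sum_congr rfl fun i _ => by ring
  have hquad := quadratic_growth (q := Real.sqrt Q) (R := Real.sqrt V) (s := Real.sqrt k)
    (c₁ := c₀ / 2) hρ0
    (by rw [Real.sq_sqrt hQ0.le, Real.sq_sqrt hk'.le]; exact hQ) hμ0.le (min_le_left _ _)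
    (min_le_right _ _)
  rw [Real.sq_sqrt hQ0.le, Real.sq_sqrt hk'.le, Real.sq_sqrt hV0.le] at hquad
  have hden : Real.sqrt (2 * V) = Real.sqrt 2 * Real.sqrt V := Real.sqrt_mul (by norm_num) _
  have h2 : (0 : ℝ) < Real.sqrt 2 := by positivity
  rw [hden, le_div_iff₀ (by positivity), hnum]
  have hlhs : μ / Real.sqrt 2 * Real.sqrt k * (Real.sqrt 2 * Real.sqrt V)
      = μ * (Real.sqrt k * Real.sqrt V) := by field_simp
  rw [hlhs]
  linarith

end SaturatedRandomEffectModel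

/-! ### Localisation of the Poisson maximum likelihood estimate -/

section MaximumLikelihood

variable {p : ℕ} {T : ℕ → ℕ}

/-- The Poisson log-likelihood, up to a term that does not depend on the parameter. -/
noncomputable def poissonLogLikelihood (x : (i : ℕ) → Fin (T i) → Fin p → ℝ) (k : ℕ)
    (n : (i : ℕ) → Fin (T i) → ℕ) (b : Fin p → ℝ) : ℝ :=
  ∑ i ∈ Finset.range k, ∑ t, (n i t * (x i t ⬝ᵥ b) - Real.exp (x i t ⬝ᵥ b))

lemma poissonLikelihood_eq (x : (i : ℕ) → Fin (T i) → Fin p → ℝ) (k : ℕ)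
    (n : (i : ℕ) → Fin (T i) → ℕ) (b : Fin p → ℝ) :
    poissonLikelihood T x k n b = Real.exp (poissonLogLikelihood x k n b) *
      ∏ i ∈ Finset.range k, ∏ t, ((n i t).factorial : ℝ)⁻¹ := by
  rw [poissonLikelihood, poissonLogLikelihood, Real.exp_sum, ← Finset.prod_mul_distrib]
  refine Finset.prod_congr rfl fun i _ => ?_
  rw [Real.exp_sum, ← Finset.prod_mul_distrib]
  refine Finset.prod_congr rfl fun t _ => ?_
  have hr : ((poissonRate (x i t) b : ℝ≥0) : ℝ) = Real.exp (x i t ⬝ᵥ b) := rfl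
  rw [poissonMeasure_real_singleton, hr, sub_eq_neg_add, Real.exp_add, Real.exp_nat_mul,
    div_eq_mul_inv]

lemma isPoissonMLE_iff (x : (i : ℕ) → Fin (T i) → Fin p → ℝ) (k : ℕ)
    (n : (i : ℕ) → Fin (T i) → ℕ) (b : Fin p → ℝ) : IsPoissonMLE T x k n b ↔
      ∀ b', poissonLogLikelihood x k n b' ≤ poissonLogLikelihood x k n b := by
  have hpos : 0 < ∏ i ∈ Finset.range k, ∏ t, ((n i t).factorial : ℝ)⁻¹ :=
    Finset.prod_pos fun i _ => Finset.prod_pos fun t _ => by positivity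
  simp only [IsPoissonMLE, poissonLikelihood_eq, mul_le_mul_iff_left₀ hpos, Real.exp_le_exp]

lemma continuous_poissonLogLikelihood (x : (i : ℕ) → Fin (T i) → Fin p → ℝ) (k : ℕ)
    (n : (i : ℕ) → Fin (T i) → ℕ) : Continuous (poissonLogLikelihood x k n) := by
  unfold poissonLogLikelihood dotProduct
  fun_prop

lemma concaveOn_poissonLogLikelihood (x : (i : ℕ) → Fin (T i) → Fin p → ℝ) (k : ℕ)
    (n : (i : ℕ) → Fin (T i) → ℕ) : ConcaveOn ℝ Set.univ (poissonLogLikelihood x k n) := by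
  refine ⟨convex_univ, fun b _ b' _ u v hu hv huv => ?_⟩
  simp only [poissonLogLikelihood, smul_eq_mul, Finset.mul_sum, ← Finset.sum_add_distrib]
  refine Finset.sum_le_sum fun i _ => Finset.sum_le_sum fun t _ => ?_
  have h := convexOn_exp.2 (Set.mem_univ (x i t ⬝ᵥ b)) (Set.mem_univ (x i t ⬝ᵥ b')) hu hv huv
  simp only [smul_eq_mul] at h
  rw [dotProduct_add, dotProduct_smul, dotProduct_smul, smul_eq_mul, smul_eq_mul]
  nlinarith

/-- On the segment from β to a point outside the ball with no smaller value, concavity would give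
the sphere a value at least f β. -/
lemma norm_sub_lt_of_sphere_lt {E : Type*} [NormedAddCommGroup E] [NormedSpace ℝ E] {f : E → ℝ}
    (hf : ConcaveOn ℝ Set.univ f) {β b : E} {r : ℝ} (hr : 0 < r)
    (hsphere : ∀ δ, ‖δ‖ = r → f (β + δ) < f β) (hb : f β ≤ f b) : ‖b - β‖ < r := by
  by_contra! hge
  have hpos : 0 < ‖b - β‖ := hr.trans_le hge
  set s := r / ‖b - β‖ with hs
  have hs0 : 0 < s := by positivity
  have hs1 : s ≤ 1 := (div_le_one hpos).2 hge
  have h1 := hsphere (s • (b - β)) (by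
    rw [norm_smul, Real.norm_of_nonneg hs0.le, hs]; field_simp)
  have h2 := hf.2 (Set.mem_univ β) (Set.mem_univ b) (sub_nonneg.2 hs1) hs0.le (by ring)
  rw [show (1 - s) • β + s • b = β + s • (b - β) by rw [sub_smul, smul_sub, one_smul]; abel] at h2
  simp only [smul_eq_mul] at h2
  nlinarith

lemma exists_isPoissonMLE {x : (i : ℕ) → Fin (T i) → Fin p → ℝ} {k : ℕ}
    {n : (i : ℕ) → Fin (T i) → ℕ} {β : Fin p → ℝ} {r : ℝ} (hr : 0 < r)
    (hsphere : ∀ δ : Fin p → ℝ, ‖δ‖ = r →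
      poissonLogLikelihood x k n (β + δ) < poissonLogLikelihood x k n β) :
    ∃ b, IsPoissonMLE T x k n b := by
  obtain ⟨b, hb, hmax⟩ := (isCompact_closedBall β r).exists_isMaxOn
    ⟨β, Metric.mem_closedBall_self hr.le⟩ (continuous_poissonLogLikelihood x k n).continuousOn
  refine ⟨b, (isPoissonMLE_iff x k n b).2 fun b' => ?_⟩
  by_contra! hlt
  have hβ : poissonLogLikelihood x k n β ≤ poissonLogLikelihood x k n b :=
    hmax (Metric.mem_closedBall_self hr.le)
  have hnorm := norm_sub_lt_of_sphere_lt (concaveOn_poissonLogLikelihood x k n) hr hsphere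
    (hβ.trans hlt.le)
  have : poissonLogLikelihood x k n b' ≤ poissonLogLikelihood x k n b :=
    hmax (by rw [Metric.mem_closedBall, dist_eq_norm]; exact hnorm.le)
  linarith

lemma abs_dotProduct_le {v w : Fin p → ℝ} {B : ℝ} (hv : ∀ j, |v j| ≤ B) :
    |v ⬝ᵥ w| ≤ p * B * ‖w‖ := by
  calc |v ⬝ᵥ w| ≤ ∑ j, |v j * w j| := Finset.abs_sum_le_sum_abs _ _
    _ ≤ ∑ _j : Fin p, B * ‖w‖ := by
        refine Finset.sum_le_sum fun j _ => ?_
        rw [abs_mul]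
        exact mul_le_mul (hv j) (norm_le_pi_norm w j) (abs_nonneg _)
          ((abs_nonneg _).trans (hv j))
    _ = _ := by simp; ring

lemma norm_sq_le_dotProduct_self (v : Fin p → ℝ) : ‖v‖ ^ 2 ≤ v ⬝ᵥ v := by
  have h0 : 0 ≤ v ⬝ᵥ v := Finset.sum_nonneg fun j _ => mul_self_nonneg (v j)
  have h : ‖v‖ ≤ Real.sqrt (v ⬝ᵥ v) := by
    refine (pi_norm_le_iff_of_nonneg (Real.sqrt_nonneg _)).2 fun j => ?_
    rw [Real.norm_eq_abs, ← Real.sqrt_sq_eq_abs]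
    refine Real.sqrt_le_sqrt ?_
    rw [sq]
    exact Finset.single_le_sum (f := fun j => v j * v j) (fun j _ => mul_self_nonneg (v j))
      (Finset.mem_univ j)
  calc ‖v‖ ^ 2 ≤ Real.sqrt (v ⬝ᵥ v) ^ 2 := pow_le_pow_left₀ (norm_nonneg v) h 2
    _ = _ := Real.sq_sqrt h0

/-- The left side is (1 + u/2)²; the bound 1 + u/2 ≤ exp(u/2) may be squared because u ≥ −2. -/
lemma one_add_add_sq_le_exp {u : ℝ} (hu : -2 ≤ u) : 1 + u + u ^ 2 / 4 ≤ Real.exp u := by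
  have h1 := Real.add_one_le_exp (u / 2)
  have h2 : Real.exp u = Real.exp (u / 2) ^ 2 := by rw [← Real.exp_nat_mul]; congr 1; push_cast; ring
  rw [h2]
  nlinarith

/-- If the score at `β` is small in comparison with the Fisher information, then the likelihood is
smaller than at `β` on a small sphere around `β`. -/
lemma poissonLogLikelihood_lt_of_score_le {x : (i : ℕ) → Fin (T i) → Fin p → ℝ} {k : ℕ}
    {n : (i : ℕ) → Fin (T i) → ℕ} {β : Fin p → ℝ} {B κ r ε : ℝ} (hk : 0 < k) (hr : 0 < r)
    (hB : ∀ i t j, |x i t j| ≤ B) (hBr : p * B * r ≤ 2) (hε : p * ε < κ * r / 4) (hκ : 0 < κ)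
    (hinfo : ∀ v : Fin p → ℝ, κ * k * (v ⬝ᵥ v) ≤
      ∑ i ∈ Finset.range k, ∑ t, (poissonRate (x i t) β : ℝ) * (x i t ⬝ᵥ v) ^ 2)
    (hscore : ∀ j, |∑ i ∈ Finset.range k, ∑ t, x i t j * (n i t - (poissonRate (x i t) β : ℝ))|
      ≤ ε * k) {δ : Fin p → ℝ} (hδ : ‖δ‖ = r) :
    poissonLogLikelihood x k n (β + δ) < poissonLogLikelihood x k n β := by
  have hk' : (0 : ℝ) < k := by exact_mod_cast hk
  -- A second-order expansion at β with a quadratic loss, valid because |x·δ| ≤ 2 on the sphere.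
  have hterm : ∀ i t, n i t * (x i t ⬝ᵥ (β + δ)) - Real.exp (x i t ⬝ᵥ (β + δ)) ≤
      n i t * (x i t ⬝ᵥ β) - Real.exp (x i t ⬝ᵥ β) +
        (x i t ⬝ᵥ δ) * (n i t - (poissonRate (x i t) β : ℝ)) -
        1 / 4 * ((poissonRate (x i t) β : ℝ) * (x i t ⬝ᵥ δ) ^ 2) := by
    intro i t
    have hu := abs_dotProduct_le (w := δ) (hB i t)
    rw [hδ] at hu
    have hexp := one_add_add_sq_le_exp (u := x i t ⬝ᵥ δ) (by linarith [(abs_le.1 (hu.trans hBr)).1])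
    rw [show ((poissonRate (x i t) β : ℝ≥0) : ℝ) = Real.exp (x i t ⬝ᵥ β) from rfl, dotProduct_add,
      Real.exp_add]
    nlinarith [mul_le_mul_of_nonneg_left hexp (Real.exp_pos (x i t ⬝ᵥ β)).le]
  have hlin : ∑ i ∈ Finset.range k, ∑ t, (x i t ⬝ᵥ δ) * (n i t - (poissonRate (x i t) β : ℝ))
      ≤ p * ε * r * k := by
    calc _ = ∑ j, δ j * ∑ i ∈ Finset.range k, ∑ t,
          x i t j * (n i t - (poissonRate (x i t) β : ℝ)) := by
          simp only [dotProduct, Finset.sum_mul, Finset.mul_sum]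
          rw [Finset.sum_comm (s := Finset.univ) (t := Finset.range k)]
          refine Finset.sum_congr rfl fun i _ => ?_
          rw [Finset.sum_comm]
          exact Finset.sum_congr rfl fun j _ => Finset.sum_congr rfl fun t _ => by ring
      _ ≤ ∑ _j : Fin p, r * (ε * k) := by
          refine Finset.sum_le_sum fun j _ => (le_abs_self _).trans ?_
          rw [abs_mul]
          exact mul_le_mul (hδ ▸ norm_le_pi_norm δ j) (hscore j) (abs_nonneg _) hr.le
      _ = _ := by simp; ring
  have hquad : κ * k * r ^ 2 ≤
      ∑ i ∈ Finset.range k, ∑ t, (poissonRate (x i t) β : ℝ) * (x i t ⬝ᵥ δ) ^ 2 := by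
    refine le_trans ?_ (hinfo δ)
    rw [← hδ]
    exact mul_le_mul_of_nonneg_left (norm_sq_le_dotProduct_self δ) (by positivity)
  have hsum : poissonLogLikelihood x k n (β + δ) ≤ poissonLogLikelihood x k n β +
      ∑ i ∈ Finset.range k, ∑ t, (x i t ⬝ᵥ δ) * (n i t - (poissonRate (x i t) β : ℝ)) -
      1 / 4 * ∑ i ∈ Finset.range k, ∑ t, (poissonRate (x i t) β : ℝ) * (x i t ⬝ᵥ δ) ^ 2 := by
    simp only [poissonLogLikelihood, Finset.mul_sum, ← Finset.sum_add_distrib,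
      ← Finset.sum_sub_distrib]
    exact Finset.sum_le_sum fun i _ => Finset.sum_le_sum fun t _ => hterm i t
  have hfin : p * ε * r * k < 1 / 4 * (κ * k * r ^ 2) := by
    have := mul_lt_mul_of_pos_right hε (mul_pos hr hk')
    linarith
  linarith

lemma totalRate_le_of_abs_le {x : (i : ℕ) → Fin (T i) → Fin p → ℝ} {b b' : Fin p → ℝ} {i : ℕ}
    {D : ℝ} (h : ∀ t, |x i t ⬝ᵥ (b - b')| ≤ D) :
    totalRate x b i ≤ Real.exp D * totalRate x b' i := by
  rw [totalRate, totalRate, Finset.mul_sum]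
  refine Finset.sum_le_sum fun t _ => ?_
  have h1 := (abs_le.1 (h t)).2
  rw [dotProduct_sub] at h1
  rw [show ((poissonRate (x i t) b : ℝ≥0) : ℝ) = Real.exp (x i t ⬝ᵥ b) from rfl,
    show ((poissonRate (x i t) b' : ℝ≥0) : ℝ) = Real.exp (x i t ⬝ᵥ b') from rfl, ← Real.exp_add]
  exact Real.exp_le_exp.2 (by linarith)

end MaximumLikelihood

/-! ### The score at the true parameter and the upper bound of order √k -/

namespace SaturatedRandomEffectModel

variable {Ω : Type*} [MeasurableSpace Ω] {P : Measure Ω} [IsProbabilityMeasure P]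
    {p : ℕ} {T : ℕ → ℕ} {x : (i : ℕ) → Fin (T i) → Fin p → ℝ} {β : Fin p → ℝ}
    {τ : ℝ} {θ : (i : ℕ) → Fin (T i) → Ω → ℝ≥0} {N : (i : ℕ) → Fin (T i) → Ω → ℕ}

lemma tendsto_measure_exists_score_gt (h : SaturatedRandomEffectModel P T x β τ θ N) {A B : ℝ}
    (ha : ModerateScale (fun i => 1 + totalRate x β i) A) (hB : ∀ i t j, |x i t j| ≤ B)
    {ε : ℝ} (hε : 0 < ε) :
    Tendsto (fun k : ℕ => P {ω | ∃ j, ε * k < |∑ i ∈ Finset.range k, ∑ t,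
      x i t j * (N i t ω - (poissonRate (x i t) β : ℝ))|}) atTop (𝓝 0) := by
  have hj : ∀ j, Tendsto (fun k : ℕ => P {ω | ε * k ≤ |∑ i ∈ Finset.range k,
      ((∑ t, x i t j * (N i t ω : ℝ)) - ∫ ω', ∑ t, x i t j * (N i t ω' : ℝ) ∂P)|})
      atTop (𝓝 0) := by
    intro j
    refine tendsto_measure_abs_centered_sum_ge ha (C := B ^ 2 * (1 + τ ^ 2))
      (fun i => h.memLp_linear i fun t => x i t j)
      (h.indepFun_individuals fun i f => ∑ t, x i t j * (f t : ℝ)) (fun i => ?_) hε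
    rw [h.variance_linear]
    have hΛ := totalRate_nonneg x β i
    calc _ ≤ ∑ t, B ^ 2 * (poissonRate (x i t) β + τ ^ 2 * (poissonRate (x i t) β : ℝ) ^ 2) := by
          refine Finset.sum_le_sum fun t _ => ?_
          refine mul_le_mul_of_nonneg_right ?_ (by positivity)
          rw [← sq_abs]
          exact pow_le_pow_left₀ (abs_nonneg _) (hB i t j) 2
      _ = B ^ 2 * (totalRate x β i + τ ^ 2 * ∑ t, (poissonRate (x i t) β : ℝ) ^ 2) := by
          rw [← Finset.mul_sum, Finset.sum_add_distrib, ← Finset.mul_sum]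
          rfl
      _ ≤ B ^ 2 * (totalRate x β i + τ ^ 2 * totalRate x β i ^ 2) := by
          gcongr; exact sum_rate_sq_le x β i
      _ ≤ B ^ 2 * ((1 + totalRate x β i) ^ 4 + τ ^ 2 * (1 + totalRate x β i) ^ 4) := by
          have h1 : (1 : ℝ) ≤ 1 + totalRate x β i := by linarith
          gcongr
          · exact (le_add_of_nonneg_left zero_le_one).trans (le_self_pow₀ h1 (by norm_num))
          · exact (pow_le_pow_left₀ hΛ (by linarith) 2).trans (pow_le_pow_right₀ h1 (by norm_num))
      _ = _ := by ring
  have hsum : Tendsto (fun k : ℕ => ∑ j, P {ω | ε * k ≤ |∑ i ∈ Finset.range k,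
      ((∑ t, x i t j * (N i t ω : ℝ)) - ∫ ω', ∑ t, x i t j * (N i t ω' : ℝ) ∂P)|})
      atTop (𝓝 0) := by
    have := tendsto_finsetSum (Finset.univ : Finset (Fin p)) fun j _ => hj j
    simpa using this
  refine tendsto_of_tendsto_of_tendsto_of_le_of_le tendsto_const_nhds hsum
    (fun _ => zero_le) fun k => ?_
  refine le_trans (measure_mono fun ω hω => ?_) (measure_iUnion_fintype_le P _)
  simp only [Set.mem_ofPred_eq, Set.mem_iUnion] at hω ⊢
  obtain ⟨j, hωj⟩ := hω
  refine ⟨j, hωj.le.trans (le_of_eq ?_)⟩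
  congr 1
  refine Finset.sum_congr rfl fun i _ => ?_
  rw [h.integral_linear, ← Finset.sum_sub_distrib]
  exact Finset.sum_congr rfl fun t _ => by ring

/-- In a regular design the score statistic grows at most like `√k`. -/
theorem exists_tendsto_measure_pinquetStatistic_le (h : SaturatedRandomEffectModel P T x β τ θ N)
    {m : ℕ} (hT : ∀ i, T i ≤ m) {c₀ : ℝ} (hc₀ : 0 < c₀)
    (hrate : Tendsto (fun k : ℕ => (∑ i ∈ Finset.range k, totalRate x β i ^ 2) / (k : ℝ))
      atTop (𝓝 c₀)) {βhat : ℕ → Ω → Fin p → ℝ}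
    (hβhat : ∀ k, ∀ᵐ ω ∂P, (∃ b, IsPoissonMLE T x k (fun i t => N i t ω) b) →
      IsPoissonMLE T x k (fun i t => N i t ω) (βhat k ω))
    (hreg : RegularDesign T x β) :
    ∃ C : ℝ, Tendsto (fun k : ℕ => P {ω |
      pinquetStatistic T x k (fun i t => N i t ω) (βhat k ω) ≤ C * Real.sqrt k})
      atTop (𝓝 1) := by
  obtain ⟨⟨B', hB'⟩, κ, hκ, hinfo⟩ := hreg
  set B := |B'|
  have hB : ∀ i t j, |x i t j| ≤ B := fun i t j => (hB' i t j).trans (le_abs_self _)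
  have hB0 : 0 ≤ B := abs_nonneg _
  obtain ⟨A, ha⟩ := ModerateScale.of_tendsto_average (totalRate_nonneg x β) hrate
  have hS := h.uniformlyIntegrableCounts hT
  obtain ⟨C₁, hC₁, hsq⟩ := exists_tendsto_measure_sum_sq_gt (D := 2 + τ ^ 2) ha hS fun i => by
    rw [h.integral_totalCount_sq]
    have h1 := totalRate_nonneg x β i
    have h2 := mul_le_mul_of_nonneg_left (sum_rate_sq_le x β i) (sq_nonneg τ)
    nlinarith [mul_nonneg (sq_nonneg τ) h1, sq_nonneg τ]
  -- The radius keeps |x·(b − β)| ≤ 2 in the ball, which yields both the quadratic bound on exp and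
  -- the factor e² between rates.
  set r := 2 / (p * B + 1) with hr
  have hr0 : 0 < r := by positivity
  have hBr : p * B * r ≤ 2 := by
    rw [hr, ← mul_div_assoc, div_le_iff₀ (by positivity)]
    nlinarith [mul_nonneg (Nat.cast_nonneg (α := ℝ) p) hB0]
  set ε := κ * r / (8 * (p + 1)) with hε
  have hε0 : 0 < ε := by positivity
  have hpε : p * ε < κ * r / 4 := by
    rw [hε, ← mul_div_assoc, div_lt_div_iff₀ (by positivity) (by norm_num)]
    have := mul_pos hκ hr0
    nlinarith [mul_nonneg (Nat.cast_nonneg (α := ℝ) p) this.le]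
  have hscore := h.tendsto_measure_exists_score_gt ha hB hε0
  -- The exceptional null set depends on k, so it joins the bad events.
  have hnull : Tendsto (fun k : ℕ => P {ω | ¬ ((∃ b, IsPoissonMLE T x k (fun i t => N i t ω) b) →
      IsPoissonMLE T x k (fun i t => N i t ω) (βhat k ω))}) atTop (𝓝 0) := by
    have : ∀ k, P {ω | ¬ ((∃ b, IsPoissonMLE T x k (fun i t => N i t ω) b) →
      IsPoissonMLE T x k (fun i t => N i t ω) (βhat k ω))} = 0 := fun k => ae_iff.1 (hβhat k)
    simp only [this]
    exact tendsto_const_nhds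
  have hA := ha.nonneg
  set c₂ := Real.exp (-2) * Real.sqrt (c₀ / 2) with hc₂
  have hc₂0 : 0 < c₂ := by positivity
  refine ⟨(C₁ + Real.exp 2 ^ 2 * A) / c₂, tendsto_measure_one_of_compl
    (tendsto_measure_zero_union (tendsto_measure_zero_union hsq hscore) hnull) ?_⟩
  filter_upwards [eventually_sum_totalRate_sq_ge hc₀ hrate, hinfo] with k hk hinfok ω hω
  obtain ⟨hk0, hQ⟩ := hk
  have hk' : (0 : ℝ) < k := by exact_mod_cast hk0
  simp only [Set.mem_union, Set.mem_ofPred_eq, not_or, not_lt, not_exists, not_not] at hω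
  obtain ⟨⟨hω1, hω2⟩, hω3⟩ := hω
  have hsphere : ∀ δ : Fin p → ℝ, ‖δ‖ = r → poissonLogLikelihood x k (fun i t => N i t ω) (β + δ)
      < poissonLogLikelihood x k (fun i t => N i t ω) β := fun δ hδ =>
    poissonLogLikelihood_lt_of_score_le hk0 hr0 hB hBr hpε hκ hinfok hω2 hδ
  have hMLE := hω3 (exists_isPoissonMLE hr0 hsphere)
  set b := βhat k ω with hb
  have hnorm : ‖b - β‖ < r := norm_sub_lt_of_sphere_lt
    (concaveOn_poissonLogLikelihood x k fun i t => N i t ω) hr0 hsphere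
    ((isPoissonMLE_iff _ _ _ _).1 hMLE β)
  have hdot : ∀ i t, |x i t ⬝ᵥ (b - β)| ≤ 2 := fun i t =>
    (abs_dotProduct_le (hB i t)).trans ((mul_le_mul_of_nonneg_left hnorm.le (by positivity)).trans hBr)
  have hup : ∀ i, totalRate x b i ≤ Real.exp 2 * totalRate x β i := fun i =>
    totalRate_le_of_abs_le (hdot i)
  have hlow : ∀ i, totalRate x β i ≤ Real.exp 2 * totalRate x b i := fun i =>
    totalRate_le_of_abs_le fun t => by
      rw [← neg_sub, dotProduct_neg, abs_neg]; exact hdot i t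
  rw [pinquetStatistic_eq]
  have hnum : ∑ i ∈ Finset.range k,
      (((totalCount N i ω : ℝ) - totalRate x b i) ^ 2 - totalCount N i ω)
      ≤ (C₁ + Real.exp 2 ^ 2 * A) * k := by
    -- The cross term and the subtracted count are nonpositive and can be dropped.
    calc _ ≤ ∑ i ∈ Finset.range k, ((totalCount N i ω : ℝ) ^ 2 +
          Real.exp 2 ^ 2 * (1 + totalRate x β i) ^ 2) := by
          refine Finset.sum_le_sum fun i _ => ?_
          have h1 := totalRate_nonneg x b i
          have h2 := totalRate_nonneg x β i
          have h3 : (0 : ℝ) ≤ totalCount N i ω := Nat.cast_nonneg _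
          have h4 : totalRate x b i ^ 2 ≤ Real.exp 2 ^ 2 * (1 + totalRate x β i) ^ 2 := by
            rw [← mul_pow]
            exact pow_le_pow_left₀ h1 ((hup i).trans (by gcongr; linarith)) 2
          nlinarith [mul_nonneg h3 h1]
      _ ≤ C₁ * k + Real.exp 2 ^ 2 * (A * k) := by
          rw [Finset.sum_add_distrib, ← Finset.mul_sum]
          exact add_le_add hω1 (mul_le_mul_of_nonneg_left (ha.sum_sq_le k) (by positivity))
      _ = _ := by ring
  have hden : c₂ * Real.sqrt k ≤ Real.sqrt (2 * ∑ i ∈ Finset.range k, totalRate x b i ^ 2) := by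
    refine Real.le_sqrt_of_sq_le ?_
    rw [hc₂, mul_pow, mul_pow, Real.sq_sqrt hk'.le, Real.sq_sqrt (by positivity)]
    have h5 : Real.exp (-2) ^ 2 * ∑ i ∈ Finset.range k, totalRate x β i ^ 2
        ≤ ∑ i ∈ Finset.range k, totalRate x b i ^ 2 := by
      rw [Finset.mul_sum]
      refine Finset.sum_le_sum fun i _ => ?_
      rw [← mul_pow]
      refine pow_le_pow_left₀ (mul_nonneg (Real.exp_pos _).le (totalRate_nonneg x β i)) ?_ 2
      rw [Real.exp_neg, inv_mul_le_iff₀ (Real.exp_pos 2)]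
      exact hlow i
    have h6 : 0 ≤ ∑ i ∈ Finset.range k, totalRate x b i ^ 2 :=
      Finset.sum_nonneg fun i _ => sq_nonneg _
    have h7 := mul_le_mul_of_nonneg_left hQ (sq_nonneg (Real.exp (-2)))
    linarith
  have hsk : 0 < Real.sqrt k := Real.sqrt_pos.2 hk'
  have hden0 : 0 < c₂ * Real.sqrt k := by positivity
  rw [div_le_iff₀ (hden0.trans_le hden)]
  refine hnum.trans ?_
  have hC0 : 0 ≤ C₁ + Real.exp 2 ^ 2 * A := by positivity
  calc (C₁ + Real.exp 2 ^ 2 * A) * k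
      = (C₁ + Real.exp 2 ^ 2 * A) / c₂ * Real.sqrt k * (c₂ * Real.sqrt k) := by
        have := Real.mul_self_sqrt hk'.le
        field_simp
        rw [Real.sq_sqrt hk'.le]
    _ ≤ _ := by gcongr

end SaturatedRandomEffectModel

/-! ### The growth and consistency statements -/

theorem theorem1 {Ω : Type*} [MeasurableSpace Ω] (P : Measure Ω) [IsProbabilityMeasure P]
    {p : ℕ} (T : ℕ → ℕ) (x : (i : ℕ) → Fin (T i) → Fin p → ℝ) (β : Fin p → ℝ)
    (τ : ℝ) (hτ : 0 < τ)
    (θ : (i : ℕ) → Fin (T i) → Ω → ℝ≥0) (N : (i : ℕ) → Fin (T i) → Ω → ℕ)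
    (hmodel : SaturatedRandomEffectModel P T x β τ θ N)
    (hT : ∃ M : ℕ, ∀ i, T i ≤ M)
    (hrate : ∃ c₀ : ℝ, 0 < c₀ ∧
      Tendsto (fun k : ℕ =>
        (∑ i ∈ Finset.range k, (∑ t, (poissonRate (x i t) β : ℝ)) ^ 2) / (k : ℝ)) atTop (𝓝 c₀))
    (βhat : ℕ → Ω → Fin p → ℝ) (hβhat_meas : ∀ k, Measurable (βhat k))
    (hβhat : ∀ k, ∀ᵐ ω ∂P,
      (∃ b, IsPoissonMLE T x k (fun i t => N i t ω) b) →
        IsPoissonMLE T x k (fun i t => N i t ω) (βhat k ω)) :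
    (∃ c : ℝ, 0 < c ∧
      Tendsto (fun k : ℕ => P {ω | c * Real.sqrt k ≤
        pinquetStatistic T x k (fun i t => N i t ω) (βhat k ω)}) atTop (𝓝 1)) ∧
    (∀ α z : ℝ, 0 < α → α < 1 → cdf (gaussianReal 0 1) z = 1 - α →
      Tendsto (fun k : ℕ => P {ω | z ≤
        pinquetStatistic T x k (fun i t => N i t ω) (βhat k ω)}) atTop (𝓝 1)) ∧
    (RegularDesign T x β →
      ∃ C : ℝ, Tendsto (fun k : ℕ => P {ω |
        pinquetStatistic T x k (fun i t => N i t ω) (βhat k ω) ≤ C * Real.sqrt k})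
          atTop (𝓝 1)) := by
  obtain ⟨m, hm⟩ := hT
  obtain ⟨c₀, hc₀, hlim⟩ := hrate
  obtain ⟨c, hc, hgrow⟩ :=
    hmodel.exists_tendsto_measure_pinquetStatistic_ge hτ hm hc₀ hlim
  have hlower : Tendsto (fun k : ℕ => P {ω | c * Real.sqrt k ≤
      pinquetStatistic T x k (fun i t => N i t ω) (βhat k ω)}) atTop (𝓝 1) :=
    tendsto_of_tendsto_of_tendsto_of_le_of_le hgrow tendsto_const_nhds
      -- The lower bound holds for all parameters at once, so the random estimate may be
      -- substituted.
      (fun k => measure_mono fun ω hω => hω (βhat k ω)) fun _ => prob_le_one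
  refine ⟨⟨c, hc, hlower⟩, fun α z _ _ _ => ?_, fun hreg =>
    hmodel.exists_tendsto_measure_pinquetStatistic_le hm hc₀ hlim hβhat hreg⟩
  have hbig : ∀ᶠ k : ℕ in atTop, z ≤ c * Real.sqrt k :=
    ((Real.tendsto_sqrt_atTop.comp tendsto_natCast_atTop_atTop).const_mul_atTop hc).eventually_ge_atTop z
  refine tendsto_of_tendsto_of_tendsto_of_le_of_le' hlower tendsto_const_nhds ?_
    (Eventually.of_forall fun _ => prob_le_one)
  filter_upwards [hbig] with k hk
  exact measure_mono fun ω hω => hk.trans hω
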